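/- **Pólya–Eggenberger-like walk with component-wise exponential displacements.** Let $c\ge 1$ and let $X(t)=(X_1(t),\dots,X_c(t))$, $t\ge 0$, be the continuum Pólya-like random walk in $\mathbb{R}^c$ started at a deterministic point $X(0)=(x_1,\dots,x_c)\neq 0$ with all $x_i\ge 0$, whose navigation matrix is diagonal with independent $\mathrm{Exp}(1)$ random diagonal entries $A_1,\dots,A_c$. That is: given the history up to a renewal (or up to time $0$) at which the walk is at $Y$, the waiting time until the next renewal is exponential with rate $\sum_k Y_k$, the type of that renewal is $j$ with probability $Y_j/\sum_k Y_k$, a fresh copy of the navigation matrix, independent of the history, is drawn, and these three are independent; if the type is $j$, then $A_j$ is added to the $j$-th coordinate. Let $W$ be the principal real branch of Lambert's function on $[-1/e,\infty)$ (the inverse of $w\mapsto we^w$ on $[-1,\infty)$), and let $T(z)=-W(-z)$, $z\le 1/e$, be the tree function. 1. For all $i$, all $t\ge 0$ and all real $u<1$ with $u e^{t-u}\le 1/e$, the variable $e^{uX_i(t)}$ is integrable and $$\mathbb{E}\,e^{uX_i(t)}=\exp\bigl(-x_i\,W(-u e^{t-u})\bigr).$$ 2. For all $i$ and all real $s\le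 1/e$, $s\ne 0$, $$\lim_{t\to\infty}\mathbb{E}\exp\bigl(s e^{-t}X_i(t)\bigr)=\Bigl(\frac{T(s)}{s}\Bigr)^{x_i}.$$ 3. For every $i$ there is a probability law on $\mathbb{R}$ whose moment generating function is $(T(s)/s)^{x_i}$ for all $s\le 1/e$, $s\neq 0$. If $W_1^*,\dots,W_c^*$ are independent random variables such that $W_i^*$ has this moment generating function for each $i$, then $e^{-t}X(t)$ converges in distribution to $(W_1^*,\dots,W_c^*)$ as $t\to\infty$. In particular, if $x_i=1$ for all $i$, then $\mathbb{E}\,e^{uX_i(t)}=e^{-W(-ue^{t-u})}$, and the limit is a vector of independent Lambert random variables, each with moment generating function $T(s)/s$. -/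

import Mathlib

open MeasureTheory ProbabilityTheory Filter Topology

noncomputable section

/-- Real matrices carry the product σ-algebra of their entries. -/
instance matrixMeasurableSpace (c : ℕ) : MeasurableSpace (Matrix (Fin c) (Fin c) ℝ) :=
  inferInstanceAs (MeasurableSpace (Fin c → Fin c → ℝ))

/-- The position in `ℝ^c` after `n` renewals of a walk that starts at `x`: the `n`-th renewal
(counted from `0`) has type `colour n`, and the walk moves by the row of that type of the
navigation matrix `nav n` in force at that renewal. -/
def positionAfter {Ω : Type*} {c : ℕ} (x : Fin c → ℝ) (colour : ℕ → Ω → Fin c)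
    (nav : ℕ → Ω → Matrix (Fin c) (Fin c) ℝ) : ℕ → Ω → Fin c → ℝ
  | 0, _ => x
  | n + 1, ω => fun j => positionAfter x colour nav n ω j + nav n ω (colour n ω) j

/-- A continuum Pólya-like random walk on the probability space `(Ω, P)`, with starting point `x`
and with a random navigation matrix of law `ν`, drawn afresh at each renewal.

Given the history up to the `n`-th renewal, at which the position is `Y`, the next waiting time
is exponential with rate `∑ k, Y k`, the type of the next renewal is `j` with probability
`Y j / ∑ k, Y k`, the navigation matrix used has law `ν`, and these three are independent. -/
structure ContinuumPolyaWalk {Ω : Type*} [mΩ : MeasurableSpace Ω] (P : Measure Ω) {c : ℕ}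
    (ν : Measure (Matrix (Fin c) (Fin c) ℝ)) (x : Fin c → ℝ) where
  /-- the waiting time between the `n`-th renewal (time `0` if `n = 0`) and the next one -/
  wait : ℕ → Ω → ℝ
  /-- the type of the renewal that ends the waiting time `wait n` -/
  colour : ℕ → Ω → Fin c
  /-- the navigation matrix used at that renewal -/
  nav : ℕ → Ω → Matrix (Fin c) (Fin c) ℝ
  /-- the information available after `n` renewals -/
  history : Filtration ℕ mΩ
  measurable_wait : ∀ n, Measurable[history (n + 1)] (wait n)
  measurable_colour : ∀ n, Measurable[history (n + 1)] (colour n)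
  measurable_nav : ∀ n, Measurable[history (n + 1)] (nav n)
  cond_law : ∀ (n : ℕ) (a : ℝ), 0 ≤ a → ∀ (j : Fin c) (B : Set (Matrix (Fin c) (Fin c) ℝ)),
    MeasurableSet B →
      P⟦{ω | a < wait n ω ∧ colour n ω = j ∧ nav n ω ∈ B} | history n⟧ =ᵐ[P] fun ω =>
        Real.exp (-(a * ∑ k, positionAfter x colour nav n ω k)) *
          (positionAfter x colour nav n ω j / ∑ k, positionAfter x colour nav n ω k) * ν.real B

namespace ContinuumPolyaWalk

variable {Ω : Type*} [MeasurableSpace Ω] {P : Measure Ω} {c : ℕ}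
  {ν : Measure (Matrix (Fin c) (Fin c) ℝ)} {x : Fin c → ℝ}

/-- The time of the `n`-th renewal; `renewalTime 0 = 0`. -/
def renewalTime (w : ContinuumPolyaWalk P ν x) (n : ℕ) (ω : Ω) : ℝ :=
  ∑ k ∈ Finset.range n, w.wait k ω

/-- The number of renewals in the time interval `(0, t]`. -/
def renewalCount (w : ContinuumPolyaWalk P ν x) (t : ℝ) (ω : Ω) : ℕ :=
  Set.ncard {n : ℕ | w.renewalTime (n + 1) ω ≤ t}

/-- The position `X(t)` of the walk at time `t`. -/
def X (w : ContinuumPolyaWalk P ν x) (t : ℝ) (ω : Ω) : Fin c → ℝ :=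
  positionAfter x w.colour w.nav (w.renewalCount t ω) ω

end ContinuumPolyaWalk

/-- The law of a diagonal random matrix with independent `Exp(1)` diagonal entries. -/
def expDiagonalLaw (c : ℕ) : Measure (Matrix (Fin c) (Fin c) ℝ) :=
  (Measure.pi fun _ : Fin c => expMeasure 1).map fun a => Matrix.diagonal a

theorem measurable_diagonal (c : ℕ) :
    Measurable fun a : Fin c → ℝ => (Matrix.diagonal a : Matrix (Fin c) (Fin c) ℝ) := by
  refine measurable_pi_lambda _ fun i => measurable_pi_lambda _ fun j => ?_
  by_cases h : i = j
  · subst h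
    simpa using measurable_pi_apply i
  · simp [Matrix.diagonal_apply_ne _ h]

/-- The principal branch of Lambert's `W` function on `[-1/e, ∞)`: the inverse of `w ↦ w * e ^ w`
on `[-1, ∞)`. -/
def lambertW (z : ℝ) : ℝ :=
  Function.invFunOn (fun w : ℝ => w * Real.exp w) (Set.Ici (-1)) z

/-- The tree function `T(z) = -W(-z)`, for `z ≤ 1/e`. -/
def treeFunction (z : ℝ) : ℝ := -lambertW (-z)

/-- `Z` is a Lambert random variable with parameter `r`: its moment generating function is
`(T(s)/s) ^ r` for `s ≤ 1/e` (the value at `s = 0`, by continuity, is `1` and carries no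
information). The Lambert random variable is the case `r = 1`. -/
def IsLambert {Ω : Type*} [MeasurableSpace Ω] (Z : Ω → ℝ) (P : Measure Ω) (r : ℝ) : Prop :=
  AEMeasurable Z P ∧ ∀ s : ℝ, s ≤ Real.exp (-1) → s ≠ 0 →
    Integrable (fun ω => Real.exp (s * Z ω)) P ∧ mgf Z P s = (treeFunction s / s) ^ r

end

/-!
Write `Y n` for the position after `n` renewals and `T n` for the time of the `n`-th one. By the
one-step conditional law, if exponents `v i` solve `v' = v / (1 - v)` then
`E [exp (∑ i, Y n i * v i (t - T n)); T n ≤ t]` is the same quantity at `n + 1` plus the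
contribution of the event that there are exactly `n` renewals by time `t`. Hölder's inequality
against `E exp (-|Y n|) = exp (-|x|) / 2 ^ n` makes the remainder vanish as `n → ∞`, so that
`E exp (∑ i, u i * X(t) i) = exp (∑ i, x i * v i t)` with `v i 0 = u i`; the case `u = 0` excludes
explosion. The equation is solved by `v t = T(u e ^ (t - u))`, with `T` the tree function. At
`u e ^ (t - u) = 1 / e` the solution reaches `1`, where the equation is singular; this case follows
by letting `u` increase to the boundary value.

With `u = s e ^ (-t)` these moments converge to `exp (∑ i, x i * T(s i))`, jointly in the
coordinates and for all small `s`. Exponential moments bounded near the origin give tightness, and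
an analytic moment generating function determines the limit along every linear form.
-/

open scoped ENNReal BoundedContinuousFunction

theorem ext_prod_of_generateFrom {H E : Type*} [MeasurableSpace H] [mE : MeasurableSpace E]
    {μ ν : Measure (H × E)} [IsFiniteMeasure μ] {C : Set (Set E)}
    (hC : mE = MeasurableSpace.generateFrom C) (hCpi : IsPiSystem C)
    (hμν : ∀ A, MeasurableSet A → ∀ s ∈ insert Set.univ C, μ (A ×ˢ s) = ν (A ×ˢ s)) : μ = ν := by
  refine Measure.ext_prod fun {A s} hA hs => ?_
  have slice (ρ : Measure (H × E)) {s : Set E} (hs : MeasurableSet s) :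
      (ρ.restrict (A ×ˢ Set.univ)).map Prod.snd s = ρ (A ×ˢ s) := by
    rw [Measure.map_apply measurable_snd hs, Measure.restrict_apply (measurable_snd hs)]
    congr 1
    ext p
    simp [and_comm]
  rw [← slice _ hs, ← slice _ hs]
  congr 1
  refine ext_of_generate_finite C hC hCpi (fun s hs => ?_) ?_
  · have hs' : MeasurableSet s := hC ▸ MeasurableSpace.measurableSet_generateFrom hs
    rw [slice _ hs', slice _ hs', hμν A hA s (Set.mem_insert_of_mem _ hs)]
  · rw [slice _ .univ, slice _ .univ, hμν A hA _ (Set.mem_insert _ _)]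

theorem map_prodMk_eq_compProd_of_condExp {Ω H E : Type*} {m mΩ : MeasurableSpace Ω}
    [MeasurableSpace H] [mE : MeasurableSpace E] {P : Measure Ω} [IsFiniteMeasure P] (hm : m ≤ mΩ)
    {h : Ω → H} (hh : Measurable[m] h) {Z : Ω → E} (hZ : Measurable Z) {κ : Kernel H E}
    [IsSFiniteKernel κ] (hκ : ∀ᵐ ω ∂P, IsProbabilityMeasure (κ (h ω))) {C : Set (Set E)}
    (hC : mE = MeasurableSpace.generateFrom C) (hCpi : IsPiSystem C)
    (hcond : ∀ s ∈ C, P⟦Z ⁻¹' s | m⟧ =ᵐ[P] fun ω => (κ (h ω)).real s) :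
    P.map (fun ω => (h ω, Z ω)) = P.map h ⊗ₘ κ := by
  have hh' : Measurable h := hh.mono hm le_rfl
  have left_apply {A : Set H} {s : Set E} (hA : MeasurableSet A) (hs : MeasurableSet s) :
      P.map (fun ω => (h ω, Z ω)) (A ×ˢ s) = P (Z ⁻¹' s ∩ h ⁻¹' A) := by
    rw [Measure.map_apply (hh'.prodMk hZ) (hA.prod hs), Set.mk_preimage_prod, Set.inter_comm]
  have right_apply {A : Set H} {s : Set E} (hA : MeasurableSet A) (hs : MeasurableSet s) :
      (P.map h ⊗ₘ κ) (A ×ˢ s) = ∫⁻ ω in h ⁻¹' A, κ (h ω) s ∂P := by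
    rw [Measure.compProd_apply_prod hA hs, setLIntegral_map hA (κ.measurable_coe hs) hh']
  refine ext_prod_of_generateFrom hC hCpi fun A hA s hs => ?_
  rcases hs with rfl | hs
  · rw [left_apply hA .univ, right_apply hA .univ, Set.preimage_univ, Set.univ_inter,
      ← setLIntegral_one]
    refine lintegral_congr_ae (ae_restrict_of_ae ?_)
    filter_upwards [hκ] with ω hω
    exact measure_univ.symm
  · have hs' : MeasurableSet s := hC ▸ MeasurableSpace.measurableSet_generateFrom hs
    rw [left_apply hA hs', right_apply hA hs']
    have hint : Integrable ((Z ⁻¹' s).indicator fun _ => (1 : ℝ)) P :=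
      (integrable_const 1).indicator (hZ hs')
    have hcondA := setIntegral_condExp hm hint (hh hA)
    rw [setIntegral_congr_ae (hm _ (hh hA)) ((hcond s hs).mono fun ω hω _ => hω),
      integral_indicator_const _ (hZ hs'), measureReal_restrict_apply (hZ hs'), smul_eq_mul,
      mul_one] at hcondA
    rw [← ofReal_measureReal (measure_ne_top _ _), ← hcondA, ofReal_integral_eq_lintegral_ofReal
      (integrable_condExp.congr (hcond s hs)).integrableOn
      (ae_of_all _ fun _ => measureReal_nonneg)]
    refine lintegral_congr_ae (ae_restrict_of_ae ?_)
    filter_upwards [hκ] with ω hω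
    exact ofReal_measureReal (measure_ne_top _ _)

theorem lintegral_Ioi_mul_exp_neg {q S a : ℝ} (hq : 0 ≤ q) (hS : 0 < S) :
    ∫⁻ s in Set.Ioi a, ENNReal.ofReal (q * Real.exp (-(s * S))) =
      ENNReal.ofReal (Real.exp (-(a * S)) * (q / S)) := by
  have heq : (fun s : ℝ => q * Real.exp (-(s * S))) = fun s => q * Real.exp (-S * s) := by
    ext s; ring_nf
  have hint : IntegrableOn (fun s : ℝ => q * Real.exp (-(s * S))) (Set.Ioi a) := by
    rw [heq]; exact (exp_neg_integrableOn_Ioi a hS).const_mul q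
  rw [← ofReal_integral_eq_lintegral_ofReal hint
    (ae_of_all _ fun s => mul_nonneg hq (Real.exp_pos _).le), heq, integral_const_mul,
    integral_exp_mul_Ioi (neg_lt_zero.mpr hS) a]
  congr 1
  rw [show -S * a = -(a * S) by ring]
  field_simp

namespace ContinuumPolyaWalk

section RenewalKernel

variable {c : ℕ} (ν : Measure (Matrix (Fin c) (Fin c) ℝ)) [SFinite ν]

/-- The joint law of the waiting time, the type and the navigation matrix of the next renewal of a
walk at `y`: the type is `j` with rate `y j`. It is a probability measure when `y ≥ 0`, `y ≠ 0` and
`ν` is one. -/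
noncomputable def renewalKernel : Kernel (Fin c → ℝ) (ℝ × Fin c × Matrix (Fin c) (Fin c) ℝ) :=
  Kernel.withDensity (Kernel.const _ ((volume.restrict (Set.Ioi 0)).prod (Measure.count.prod ν)))
    fun y z => ENNReal.ofReal (y z.2.1 * Real.exp (-(z.1 * ∑ k, y k)))

theorem measurable_renewalKernel_density : Measurable (Function.uncurry
    fun (y : Fin c → ℝ) (z : ℝ × Fin c × Matrix (Fin c) (Fin c) ℝ) =>
      ENNReal.ofReal (y z.2.1 * Real.exp (-(z.1 * ∑ k, y k)))) := by
  have heval : Measurable fun p : (Fin c → ℝ) × Fin c => p.1 p.2 :=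
    measurable_from_prod_countable_left fun j => measurable_pi_apply j
  have : Measurable fun p : (Fin c → ℝ) × ℝ × Fin c × Matrix (Fin c) (Fin c) ℝ => p.1 p.2.2.1 :=
    heval.comp (by fun_prop :
      Measurable fun p : (Fin c → ℝ) × ℝ × Fin c × Matrix (Fin c) (Fin c) ℝ => (p.1, p.2.2.1))
  unfold Function.uncurry
  fun_prop

instance : IsSFiniteKernel (renewalKernel ν) :=
  Kernel.IsSFiniteKernel.withDensity _ fun _ _ => ENNReal.ofReal_ne_top

theorem lintegral_renewalKernel (y : Fin c → ℝ)
    {F : ℝ × Fin c × Matrix (Fin c) (Fin c) ℝ → ℝ≥0∞} (hF : Measurable F) :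
    ∫⁻ z, F z ∂renewalKernel ν y = ∫⁻ s in Set.Ioi 0, ∑ j,
      ENNReal.ofReal (y j * Real.exp (-(s * ∑ k, y k))) * ∫⁻ B, F (s, j, B) ∂ν := by
  have hdensity := measurable_renewalKernel_density (c := c)
  have hmul : Measurable fun z : ℝ × Fin c × Matrix (Fin c) (Fin c) ℝ =>
      ENNReal.ofReal (y z.2.1 * Real.exp (-(z.1 * ∑ k, y k))) * F z :=
    (hdensity.of_uncurry_left (x := y)).mul hF
  rw [renewalKernel, Kernel.lintegral_withDensity _ hdensity _ hF, Kernel.const_apply,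
    lintegral_prod _ hmul.aemeasurable]
  refine lintegral_congr fun s => ?_
  rw [lintegral_prod, lintegral_count, tsum_fintype]
  · dsimp only
    exact Finset.sum_congr rfl fun j _ => lintegral_const_mul _ (by fun_prop)
  · exact (hmul.comp measurable_prodMk_left).aemeasurable

theorem renewalKernel_Ioi_prod {y : Fin c → ℝ} (hy : ∀ i, 0 ≤ y i) (hS : 0 < ∑ k, y k) (a : ℝ)
    {D : Set (Fin c × Matrix (Fin c) (Fin c) ℝ)} (hD : MeasurableSet D) :
    renewalKernel ν y (Set.Ioi a ×ˢ D) = ∑ j,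
      ENNReal.ofReal (Real.exp (-(max a 0 * ∑ k, y k)) * (y j / ∑ k, y k)) *
        ν (Prod.mk j ⁻¹' D) := by
  have slice (s : ℝ) (j : Fin c) : ENNReal.ofReal (y j * Real.exp (-(s * ∑ k, y k))) *
      ∫⁻ B, (Set.Ioi a ×ˢ D).indicator (fun _ => 1) (s, j, B) ∂ν =
        (Set.Ioi a).indicator (fun s =>
          ENNReal.ofReal (y j * Real.exp (-(s * ∑ k, y k))) * ν (Prod.mk j ⁻¹' D)) s := by
    by_cases hs : s ∈ Set.Ioi a
    · rw [Set.indicator_of_mem hs, ← lintegral_indicator_one (measurable_prodMk_left hD)]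
      refine congrArg _ (lintegral_congr fun B => ?_)
      by_cases hB : (j, B) ∈ D <;> simp [Set.indicator, hs, hB]
    · simp [Set.indicator, hs]
  rw [← setLIntegral_one, ← lintegral_indicator (measurableSet_Ioi.prod hD),
    lintegral_renewalKernel ν y (measurable_const.indicator (measurableSet_Ioi.prod hD))]
  simp only [slice]
  rw [lintegral_finsetSum _ fun j _ => Measurable.indicator (by fun_prop) measurableSet_Ioi]
  refine Finset.sum_congr rfl fun j _ => ?_
  rw [lintegral_indicator measurableSet_Ioi, Measure.restrict_restrict measurableSet_Ioi,
    Set.Ioi_inter_Ioi, lintegral_mul_const _ (by fun_prop),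
    lintegral_Ioi_mul_exp_neg (hy j) hS]

theorem isProbabilityMeasure_renewalKernel [IsProbabilityMeasure ν] {y : Fin c → ℝ}
    (hy : ∀ i, 0 ≤ y i) (hS : 0 < ∑ k, y k) : IsProbabilityMeasure (renewalKernel ν y) := by
  constructor
  rw [← lintegral_one, lintegral_renewalKernel ν y measurable_const]
  simp only [lintegral_one, measure_univ, mul_one]
  rw [lintegral_finsetSum _ fun j _ => by fun_prop]
  simp only [lintegral_Ioi_mul_exp_neg (hy _) hS]
  rw [← ENNReal.ofReal_sum_of_nonneg fun j _ => by have := hy j; positivity]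
  simp [← Finset.sum_div, div_self hS.ne']

end RenewalKernel

end ContinuumPolyaWalk

theorem measurable_matrix_entry {c : ℕ} (i j : Fin c) :
    Measurable fun B : Matrix (Fin c) (Fin c) ℝ => B i j :=
  (measurable_pi_apply j).comp (measurable_pi_apply i)

theorem measurable_matrix_row {c : ℕ} :
    Measurable fun p : Fin c × Matrix (Fin c) (Fin c) ℝ => p.2 p.1 :=
  measurable_from_prod_countable_right fun i => measurable_pi_apply i

theorem isCountablySpanning_range_Ioi : IsCountablySpanning (Set.range (Set.Ioi : ℝ → Set ℝ)) :=
  ⟨fun k : ℕ => Set.Ioi (-(k : ℝ)), fun _ => ⟨_, rfl⟩, Set.iUnion_eq_univ_iff.mpr fun r =>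
    (exists_nat_gt (-r)).imp fun _ hk => neg_lt.mp hk⟩

theorem measurableSet_matrix_nonneg (c : ℕ) :
    MeasurableSet {B : Matrix (Fin c) (Fin c) ℝ | ∀ i j, 0 ≤ B i j} := by
  simp only [Set.ofPred_forall]
  exact .iInter fun i => .iInter fun j => measurableSet_le measurable_const
    (measurable_matrix_entry i j)

namespace ContinuumPolyaWalk

variable {Ω : Type*} [MeasurableSpace Ω] {P : Measure Ω} {c : ℕ}
  {ν : Measure (Matrix (Fin c) (Fin c) ℝ)} {x : Fin c → ℝ}

/-- The position `Y_n` of the walk after `n` renewals. -/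
abbrev pos (w : ContinuumPolyaWalk P ν x) (n : ℕ) (ω : Ω) : Fin c → ℝ :=
  positionAfter x w.colour w.nav n ω

theorem pos_succ (w : ContinuumPolyaWalk P ν x) (n : ℕ) (ω : Ω) :
    w.pos (n + 1) ω = w.pos n ω + w.nav n ω (w.colour n ω) := rfl

theorem renewalTime_succ (w : ContinuumPolyaWalk P ν x) (n : ℕ) (ω : Ω) :
    w.renewalTime (n + 1) ω = w.renewalTime n ω + w.wait n ω :=
  Finset.sum_range_succ _ _

theorem measurable_pos_history (w : ContinuumPolyaWalk P ν x) (n : ℕ) :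
    Measurable[w.history n] (w.pos n) := by
  induction n with
  | zero => exact measurable_const
  | succ n ih =>
    exact (ih.mono (w.history.mono n.le_succ) le_rfl).add
      (measurable_matrix_row.comp ((w.measurable_colour n).prodMk (w.measurable_nav n)))

theorem measurable_renewalTime_history (w : ContinuumPolyaWalk P ν x) (n : ℕ) :
    Measurable[w.history n] (w.renewalTime n) :=
  Finset.measurable_fun_sum _ fun k hk =>
    (w.measurable_wait k).mono (w.history.mono (Finset.mem_range.mp hk)) le_rfl

@[fun_prop]
theorem measurable_pos (w : ContinuumPolyaWalk P ν x) (n : ℕ) : Measurable (w.pos n) :=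
  (w.measurable_pos_history n).mono (w.history.le n) le_rfl

@[fun_prop]
theorem measurable_renewalTime (w : ContinuumPolyaWalk P ν x) (n : ℕ) :
    Measurable (w.renewalTime n) :=
  (w.measurable_renewalTime_history n).mono (w.history.le n) le_rfl

/-- The data of the `n`-th renewal: waiting time, type and navigation matrix. -/
def renewal (w : ContinuumPolyaWalk P ν x) (n : ℕ) (ω : Ω) :
    ℝ × Fin c × Matrix (Fin c) (Fin c) ℝ :=
  (w.wait n ω, w.colour n ω, w.nav n ω)

@[fun_prop]
theorem measurable_renewal (w : ContinuumPolyaWalk P ν x) (n : ℕ) : Measurable (w.renewal n) :=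
  ((w.measurable_wait n).prodMk ((w.measurable_colour n).prodMk (w.measurable_nav n))).mono
    (w.history.le _) le_rfl

section CondLaw

variable [IsProbabilityMeasure P] (w : ContinuumPolyaWalk P ν x) (n : ℕ)

theorem condExp_renewal_Ioi_prod {a : ℝ} (ha : 0 ≤ a)
    {D : Set (Fin c × Matrix (Fin c) (Fin c) ℝ)} (hD : MeasurableSet D) :
    P⟦w.renewal n ⁻¹' (Set.Ioi a ×ˢ D) | w.history n⟧ =ᵐ[P]
      fun ω => ∑ j, Real.exp (-(a * ∑ k, w.pos n ω k)) *
        (w.pos n ω j / ∑ k, w.pos n ω k) * ν.real (Prod.mk j ⁻¹' D) := by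
  let E (j : Fin c) : Set Ω := w.renewal n ⁻¹' (Set.Ioi a ×ˢ {j} ×ˢ (Prod.mk j ⁻¹' D))
  have hE (j : Fin c) : MeasurableSet (E j) := w.measurable_renewal n
    (measurableSet_Ioi.prod ((measurableSet_singleton j).prod (measurable_prodMk_left hD)))
  have hsum : ((w.renewal n ⁻¹' (Set.Ioi a ×ˢ D)).indicator
      fun _ => (1 : ℝ)) = ∑ j, (E j).indicator fun _ => (1 : ℝ) := by
    ext ω
    rw [Finset.sum_apply, Finset.sum_eq_single (w.colour n ω)]
    · refine Set.indicator_eq_indicator ?_ rfl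
      simp [E, renewal]
    · intro j _ hj
      exact Set.indicator_of_notMem (fun h => hj h.2.1.symm) _
    · simp
  rw [hsum]
  have hcond : ∀ᵐ ω ∂P, ∀ j, _ := ae_all_iff.mpr fun j =>
    w.cond_law n a ha j (Prod.mk j ⁻¹' D) (measurable_prodMk_left hD)
  filter_upwards [condExp_finsetSum (m := w.history n) (s := Finset.univ)
    (fun j _ => (integrable_const (1 : ℝ)).indicator (hE j)), hcond] with ω hω hcond
  rw [hω, Finset.sum_apply]
  exact Finset.sum_congr rfl fun j _ => hcond j

theorem ae_wait_pos_nav_mem [IsProbabilityMeasure ν] (hS : ∀ᵐ ω ∂P, 0 < ∑ k, w.pos n ω k)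
    {B : Set (Matrix (Fin c) (Fin c) ℝ)} (hB : MeasurableSet B) (hνB : ∀ᵐ b ∂ν, b ∈ B) :
    ∀ᵐ ω ∂P, 0 < w.wait n ω ∧ w.nav n ω ∈ B := by
  have hD : MeasurableSet (Set.univ ×ˢ B : Set (Fin c × Matrix (Fin c) (Fin c) ℝ)) :=
    MeasurableSet.univ.prod hB
  have hE := w.measurable_renewal n ((measurableSet_Ioi (a := (0 : ℝ))).prod hD)
  have hone : (fun ω => ∑ j, Real.exp (-(0 * ∑ k, w.pos n ω k)) *
      (w.pos n ω j / ∑ k, w.pos n ω k) *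
        ν.real (Prod.mk j ⁻¹' (Set.univ ×ˢ B))) =ᵐ[P] fun _ => 1 := by
    filter_upwards [hS] with ω hω
    have hνB' : ν.real B = 1 := by simp [measureReal_def, (prob_compl_eq_zero_iff hB).mp hνB]
    simp [Set.mk_preimage_prod_right, hνB', ← Finset.sum_div, div_self hω.ne']
  have hprob := integral_condExp (μ := P) (w.history.le n)
    (f := (w.renewal n ⁻¹' (Set.Ioi 0 ×ˢ Set.univ ×ˢ B)).indicator fun _ => (1 : ℝ))
  rw [integral_congr_ae ((w.condExp_renewal_Ioi_prod n le_rfl hD).trans hone),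
    integral_indicator_const _ hE, integral_const, probReal_univ, smul_eq_mul, smul_eq_mul,
    mul_one, mul_one, eq_comm, measureReal_def, ENNReal.toReal_eq_one_iff] at hprob
  filter_upwards [(prob_compl_eq_zero_iff hE).mpr hprob] with ω hω
  exact ⟨hω.1, hω.2.2⟩

end CondLaw

/-- The walk almost surely stays in the nonnegative orthant and off the origin, so that every
renewal has a positive rate. -/
def StaysInOrthant (w : ContinuumPolyaWalk P ν x) : Prop :=
  ∀ n, ∀ᵐ ω ∂P, (∀ i, 0 ≤ w.pos n ω i) ∧ 0 < ∑ k, w.pos n ω k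

variable [IsProbabilityMeasure P] [IsProbabilityMeasure ν] {w : ContinuumPolyaWalk P ν x}

theorem staysInOrthant (hν : ∀ᵐ B ∂ν, ∀ i j, 0 ≤ B i j) (hx : ∀ i, 0 ≤ x i) (hx0 : x ≠ 0)
    (w : ContinuumPolyaWalk P ν x) : w.StaysInOrthant := by
  intro n
  induction n with
  | zero =>
    exact ae_of_all _ fun ω => ⟨hx, Fintype.sum_pos (lt_of_le_of_ne hx hx0.symm)⟩
  | succ n ih =>
    filter_upwards [ih, w.ae_wait_pos_nav_mem n (ih.mono fun _ h => h.2)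
      (measurableSet_matrix_nonneg c) hν] with ω ⟨hnonneg, hpos⟩ hnav
    have hle (i : Fin c) : w.pos n ω i ≤ w.pos (n + 1) ω i :=
      le_add_of_nonneg_right (hnav.2 _ i)
    exact ⟨fun i => (hnonneg i).trans (hle i),
      hpos.trans_le (Finset.sum_le_sum fun i _ => hle i)⟩

namespace StaysInOrthant

theorem ae_wait_pos (hw : w.StaysInOrthant) (n : ℕ) : ∀ᵐ ω ∂P, 0 < w.wait n ω :=
  (w.ae_wait_pos_nav_mem n ((hw n).mono fun _ h => h.2) MeasurableSet.univ
    (ae_of_all _ fun _ => Set.mem_univ _)).mono fun _ h => h.1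

theorem condExp_renewal_eq_renewalKernel (hw : w.StaysInOrthant) (n : ℕ) (a : ℝ)
    {D : Set (Fin c × Matrix (Fin c) (Fin c) ℝ)} (hD : MeasurableSet D) :
    P⟦w.renewal n ⁻¹' (Set.Ioi a ×ˢ D) | w.history n⟧ =ᵐ[P]
      fun ω => (renewalKernel ν (w.pos n ω)).real (Set.Ioi a ×ˢ D) := by
  have hmax : ((w.renewal n ⁻¹' (Set.Ioi a ×ˢ D)).indicator
      fun _ => (1 : ℝ)) =ᵐ[P] (w.renewal n ⁻¹'
        (Set.Ioi (max a 0) ×ˢ D)).indicator fun _ => (1 : ℝ) := by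
    filter_upwards [hw.ae_wait_pos n] with ω hω
    refine Set.indicator_eq_indicator ?_ rfl
    simp [renewal, hω]
  refine (condExp_congr_ae hmax).trans
    ((w.condExp_renewal_Ioi_prod n (le_max_right a 0) hD).trans ?_)
  filter_upwards [hw n] with ω ⟨hnonneg, hpos⟩
  rw [measureReal_def, renewalKernel_Ioi_prod ν hnonneg hpos a hD,
    ENNReal.toReal_sum fun j _ => ENNReal.mul_ne_top ENNReal.ofReal_ne_top (measure_ne_top _ _)]
  refine Finset.sum_congr rfl fun j _ => ?_
  have := hnonneg j
  rw [ENNReal.toReal_mul, ENNReal.toReal_ofReal (by positivity), measureReal_def]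

theorem map_past_renewal (hw : w.StaysInOrthant) (n : ℕ) :
    P.map (fun ω => ((w.renewalTime n ω, w.pos n ω), w.renewal n ω)) =
      P.map (fun ω => (w.renewalTime n ω, w.pos n ω)) ⊗ₘ
        (renewalKernel ν).comap Prod.snd measurable_snd := by
  refine map_prodMk_eq_compProd_of_condExp (w.history.le n)
    ((w.measurable_renewalTime_history n).prodMk (w.measurable_pos_history n))
    (w.measurable_renewal n) ?_ (C := Set.image2 (· ×ˢ ·) (Set.range Set.Ioi) {D | MeasurableSet D})
    ?_ (isPiSystem_Ioi.prod MeasurableSpace.isPiSystem_measurableSet) ?_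
  · filter_upwards [hw n] with ω ⟨hnonneg, hpos⟩
    exact isProbabilityMeasure_renewalKernel ν hnonneg hpos
  · exact (generateFrom_eq_prod
      ((borel_eq_generateFrom_Ioi ℝ).symm.trans Real.borelSpace.measurable_eq.symm)
      MeasurableSpace.generateFrom_measurableSet isCountablySpanning_range_Ioi
      isCountablySpanning_measurableSet).symm
  · rintro _ ⟨_, ⟨a, rfl⟩, D, hD, rfl⟩
    exact hw.condExp_renewal_eq_renewalKernel n a hD

theorem lintegral_past_renewal (hw : w.StaysInOrthant) (n : ℕ)
    {F : (ℝ × (Fin c → ℝ)) × (ℝ × Fin c × Matrix (Fin c) (Fin c) ℝ) → ℝ≥0∞} (hF : Measurable F) :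
    ∫⁻ ω, F ((w.renewalTime n ω, w.pos n ω), w.renewal n ω) ∂P =
      ∫⁻ ω, ∫⁻ z, F ((w.renewalTime n ω, w.pos n ω), z) ∂renewalKernel ν (w.pos n ω) ∂P := by
  have hpast : Measurable fun ω => (w.renewalTime n ω, w.pos n ω) := by fun_prop
  rw [← lintegral_map hF (hpast.prodMk (w.measurable_renewal n)), hw.map_past_renewal n,
    Measure.lintegral_compProd hF, lintegral_map hF.lintegral_kernel_prod_right' hpast]
  rfl

end StaysInOrthant

end ContinuumPolyaWalk

section ExponentialDisplacements

instance isProbabilityMeasure_expMeasure_one : IsProbabilityMeasure (expMeasure 1) :=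
  isProbabilityMeasure_expMeasure one_pos

instance isProbabilityMeasure_expDiagonalLaw (c : ℕ) : IsProbabilityMeasure (expDiagonalLaw c) :=
  Measure.isProbabilityMeasure_map (measurable_diagonal c).aemeasurable

theorem ae_nonneg_expMeasure (r : ℝ) : ∀ᵐ a ∂expMeasure r, 0 ≤ a := by
  simp only [ae_iff, not_le]
  change expMeasure r (Set.Iio 0) = 0
  rw [expMeasure, gammaMeasure, withDensity_apply _ measurableSet_Iio]
  exact lintegral_exponentialPDF_of_nonpos le_rfl

theorem ae_nonneg_expDiagonalLaw (c : ℕ) : ∀ᵐ B ∂expDiagonalLaw c, ∀ i j, 0 ≤ B i j := by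
  rw [expDiagonalLaw, ae_map_iff (measurable_diagonal c).aemeasurable
    (measurableSet_matrix_nonneg c)]
  have hcoord (i : Fin c) : ∀ᵐ a ∂(Measure.pi fun _ : Fin c => expMeasure 1), 0 ≤ a i :=
    (Measure.quasiMeasurePreserving_eval _ i).ae (ae_nonneg_expMeasure 1)
  filter_upwards [ae_all_iff.mpr hcoord] with a ha i j
  rw [Matrix.diagonal_apply]
  split_ifs
  exacts [ha i, le_rfl]

theorem lintegral_exp_mul_expMeasure_one {v : ℝ} (hv : v < 1) :
    ∫⁻ a, ENNReal.ofReal (Real.exp (v * a)) ∂expMeasure 1 = ENNReal.ofReal (1 / (1 - v)) := by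
  have hpos : 0 < 1 - v := sub_pos.mpr hv
  have htilt (a : ℝ) : exponentialPDF 1 a * ENNReal.ofReal (Real.exp (v * a)) =
      ENNReal.ofReal (1 / (1 - v)) * exponentialPDF (1 - v) a := by
    rw [exponentialPDF_eq, exponentialPDF_eq]
    split_ifs
    · rw [← ENNReal.ofReal_mul (by positivity), ← ENNReal.ofReal_mul (by positivity)]
      congr 1
      rw [one_mul, one_mul, ← Real.exp_add, one_div, inv_mul_cancel_left₀ hpos.ne']
      ring_nf
    · simp
  have hmeas (r : ℝ) : Measurable (exponentialPDF r) :=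
    (measurable_exponentialPDFReal r).ennreal_ofReal
  change ∫⁻ a, _ ∂volume.withDensity (exponentialPDF 1) = _
  rw [lintegral_withDensity_eq_lintegral_mul _ (hmeas 1) (by fun_prop)]
  simp only [Pi.mul_apply, htilt]
  rw [lintegral_const_mul _ (hmeas _), lintegral_exponentialPDF_eq_one hpos, mul_one]

variable {c : ℕ} {a y : Fin c → ℝ}

theorem measurable_ofReal_exp_sum_mul {α : Type*} [MeasurableSpace α] {f g : α → Fin c → ℝ}
    (hf : Measurable f) (hg : Measurable g) :
    Measurable fun p => ENNReal.ofReal (Real.exp (∑ i, f p i * g p i)) := by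
  fun_prop

theorem lintegral_exp_sum_add_row {j : Fin c} (ha : a j < 1) :
    ∫⁻ B, ENNReal.ofReal (Real.exp (∑ i, (y + B j) i * a i)) ∂expDiagonalLaw c =
      ENNReal.ofReal (Real.exp (∑ i, y i * a i) * (1 / (1 - a j))) := by
  have hmeas : Measurable fun B : Matrix (Fin c) (Fin c) ℝ =>
      ENNReal.ofReal (Real.exp (∑ i, (y + B j) i * a i)) :=
    measurable_ofReal_exp_sum_mul (measurable_const.add (measurable_pi_apply j)) measurable_const
  have hfactor (b : Fin c → ℝ) :
      ENNReal.ofReal (Real.exp (∑ i, (y + Matrix.diagonal b j) i * a i)) =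
        ENNReal.ofReal (Real.exp (∑ i, y i * a i)) * ENNReal.ofReal (Real.exp (a j * b j)) := by
    rw [← ENNReal.ofReal_mul (Real.exp_pos _).le, ← Real.exp_add]
    simp [add_mul, Finset.sum_add_distrib, Matrix.diagonal_apply, mul_comm (b j)]
  rw [expDiagonalLaw, lintegral_map hmeas (measurable_diagonal c)]
  simp only [hfactor]
  rw [lintegral_const_mul _ (by fun_prop),
    (measurePreserving_eval (fun _ : Fin c => expMeasure 1) j).lintegral_comp
      (f := fun s => ENNReal.ofReal (Real.exp (a j * s))) (by fun_prop),
    lintegral_exp_mul_expMeasure_one ha, ENNReal.ofReal_mul (Real.exp_pos _).le]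

theorem sum_mul_lintegral_exp_sum_add_row (hy : ∀ i, 0 ≤ y i) (ha : ∀ i, a i < 1) {r : ℝ}
    (hr : 0 ≤ r) :
    ∑ j, ENNReal.ofReal (y j * r) *
        ∫⁻ B, ENNReal.ofReal (Real.exp (∑ i, (y + B j) i * a i)) ∂expDiagonalLaw c =
      ENNReal.ofReal (r * (Real.exp (∑ i, y i * a i) * ∑ j, y j / (1 - a j))) := by
  have hterm (j : Fin c) : 0 ≤ y j / (1 - a j) := div_nonneg (hy j) (sub_pos.mpr (ha j)).le
  rw [Finset.mul_sum, Finset.mul_sum, ENNReal.ofReal_sum_of_nonneg fun j _ => by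
    have := hterm j; positivity]
  refine Finset.sum_congr rfl fun j _ => ?_
  rw [lintegral_exp_sum_add_row (ha j), ← ENNReal.ofReal_mul (mul_nonneg (hy j) hr)]
  ring_nf

end ExponentialDisplacements

namespace ContinuumPolyaWalk

theorem measurable_add_row {c : ℕ} : Measurable fun p :
    (Fin c → ℝ) × ℝ × Fin c × Matrix (Fin c) (Fin c) ℝ => p.1 + p.2.2.2 p.2.2.1 :=
  measurable_fst.add (measurable_matrix_row.comp (measurable_snd.comp measurable_snd))

theorem lintegral_renewalKernel_exp_sum {c : ℕ} {y : Fin c → ℝ} (hy : ∀ i, 0 ≤ y i)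
    (hS : 0 < ∑ k, y k) {a : ℝ} (ha : a < 1) :
    ∫⁻ z, ENNReal.ofReal (Real.exp (∑ i, (y + z.2.2 z.2.1) i * a))
        ∂renewalKernel (expDiagonalLaw c) y =
      ENNReal.ofReal (1 / (1 - a)) * ENNReal.ofReal (Real.exp (∑ i, y i * a)) := by
  have hmeas : Measurable fun z : ℝ × Fin c × Matrix (Fin c) (Fin c) ℝ =>
      ENNReal.ofReal (Real.exp (∑ i, (y + z.2.2 z.2.1) i * a)) :=
    measurable_ofReal_exp_sum_mul (measurable_add_row.comp measurable_prodMk_left) measurable_const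
  rw [lintegral_renewalKernel _ _ hmeas]
  simp only [sum_mul_lintegral_exp_sum_add_row hy (fun _ => ha) (Real.exp_pos _).le]
  have hpos : 0 < 1 - a := sub_pos.mpr ha
  have hrate : 0 ≤ Real.exp (∑ i, y i * a) * ((∑ k, y k) / (1 - a)) := by positivity
  simp only [← Finset.sum_div, mul_comm (Real.exp (-(_ * _)))]
  rw [lintegral_Ioi_mul_exp_neg hrate hS, ← ENNReal.ofReal_mul (by positivity), zero_mul,
    neg_zero, Real.exp_zero]
  congr 1
  generalize Real.exp (∑ i, y i * a) = E
  field_simp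

variable {Ω : Type*} [MeasurableSpace Ω] {P : Measure Ω} [IsProbabilityMeasure P] {c : ℕ}
  {x : Fin c → ℝ} {w : ContinuumPolyaWalk P (expDiagonalLaw c) x}

/-- Every displacement has the law `Exp(1)` in the direction of its type, so the sum of the
coordinates grows by independent `Exp(1)` variables. -/
theorem StaysInOrthant.lintegral_exp_sum_pos (hw : w.StaysInOrthant) {a : ℝ} (ha : a < 1) (n : ℕ) :
    ∫⁻ ω, ENNReal.ofReal (Real.exp (∑ i, w.pos n ω i * a)) ∂P =
      ENNReal.ofReal (1 / (1 - a)) ^ n * ENNReal.ofReal (Real.exp (∑ i, x i * a)) := by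
  induction n with
  | zero => simp [pos, positionAfter]
  | succ n ih =>
    have hstep := hw.lintegral_past_renewal n (F := fun p =>
      ENNReal.ofReal (Real.exp (∑ i, (p.1.2 + p.2.2.2 p.2.2.1) i * a)))
      (measurable_ofReal_exp_sum_mul (measurable_add_row.comp
        ((measurable_snd.comp measurable_fst).prodMk measurable_snd)) measurable_const)
    rw [pow_succ', mul_assoc, ← ih, ← lintegral_const_mul _ (by fun_prop)]
    refine hstep.trans (lintegral_congr_ae ?_)
    filter_upwards [hw n] with ω ⟨hnonneg, hpos⟩
    exact lintegral_renewalKernel_exp_sum hnonneg hpos ha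

end ContinuumPolyaWalk

/-- Duhamel's formula for `φ' = ψ - S φ`. -/
theorem integral_exp_neg_mul_comp_const_sub {φ ψ : ℝ → ℝ} {S τ : ℝ} (hτ : 0 ≤ τ)
    (hφ : ContinuousOn φ (Set.Icc 0 τ)) (hψ : ContinuousOn ψ (Set.Icc 0 τ))
    (hderiv : ∀ s ∈ Set.Ioo 0 τ, HasDerivAt φ (ψ s - S * φ s) s) :
    ∫ s in (0 : ℝ)..τ, Real.exp (-(s * S)) * ψ (τ - s) = φ τ - Real.exp (-(τ * S)) * φ 0 := by
  have hmaps : Set.MapsTo (fun s => τ - s) (Set.Icc 0 τ) (Set.Icc 0 τ) :=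
    fun s hs => ⟨by linarith [hs.2], by linarith [hs.1]⟩
  have hsub : ContinuousOn (fun s => τ - s) (Set.Icc 0 τ) := by fun_prop
  have hexp : ContinuousOn (fun s => Real.exp (-(s * S))) (Set.Icc 0 τ) := by fun_prop
  have hanti : ∀ s ∈ Set.Ioo 0 τ, HasDerivAt (fun s => -(Real.exp (-(s * S)) * φ (τ - s)))
      (Real.exp (-(s * S)) * ψ (τ - s)) s := by
    intro s hs
    have hφs := (hderiv (τ - s) ⟨by linarith [hs.2], by linarith [hs.1]⟩).comp_const_sub τ s
    have hexps : HasDerivAt (fun s : ℝ => Real.exp (-(s * S)))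
        (Real.exp (-(s * S)) * (-(1 * S))) s :=
      ((hasDerivAt_id s).mul_const S).neg.exp
    exact (hexps.mul hφs).neg.congr_deriv (by ring)
  rw [intervalIntegral.integral_eq_sub_of_hasDerivAt_of_le hτ
    (f := fun s => -(Real.exp (-(s * S)) * φ (τ - s))) (hexp.mul (hφ.comp hsub hmaps)).neg hanti]
  · rw [sub_self, zero_mul, neg_zero, Real.exp_zero, one_mul, sub_zero]
    ring
  · rw [← Set.uIcc_of_le hτ] at hψ hsub hexp hmaps
    exact (hexp.mul (hψ.comp hsub hmaps)).intervalIntegrable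

/-- `v` solves `v' = v / (1 - v)` on `[0, t]` and stays below `1`: along such exponents, the
exponential moments of the walk are propagated backwards in time. Outside `[0, t]` only continuity
is asked, which makes the composition with renewal times measurable. -/
structure IsExpFlow (t : ℝ) (v : ℝ → ℝ) : Prop where
  continuous : Continuous v
  lt_one : ∀ s, v s < 1
  hasDerivAt : ∀ s ∈ Set.Ioo 0 t, HasDerivAt v (v s / (1 - v s)) s

namespace IsExpFlow

variable {c : ℕ} {t : ℝ} {v : Fin c → ℝ → ℝ} {y : Fin c → ℝ}

theorem continuous_sum_div (hv : ∀ i, IsExpFlow t (v i)) (y : Fin c → ℝ) :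
    Continuous fun s => ∑ j, y j / (1 - v j s) :=
  continuous_finsetSum _ fun j _ => continuous_const.div
    (continuous_const.sub (hv j).continuous) fun s => (sub_pos.mpr ((hv j).lt_one s)).ne'

theorem hasDerivAt_exp_sum (hv : ∀ i, IsExpFlow t (v i)) (y : Fin c → ℝ) {s : ℝ}
    (hs : s ∈ Set.Ioo 0 t) :
    HasDerivAt (fun s => Real.exp (∑ i, y i * v i s))
      (Real.exp (∑ i, y i * v i s) * ∑ j, y j / (1 - v j s) -
        (∑ k, y k) * Real.exp (∑ i, y i * v i s)) s := by
  refine (HasDerivAt.fun_sum fun i _ =>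
    ((hv i).hasDerivAt s hs).const_mul (y i)).exp.congr_deriv ?_
  rw [mul_comm (∑ k, y k), ← mul_sub, ← Finset.sum_sub_distrib]
  refine congrArg _ (Finset.sum_congr rfl fun j _ => ?_)
  have hne : 1 - v j s ≠ 0 := (sub_pos.mpr ((hv j).lt_one s)).ne'
  field_simp
  ring

theorem setLIntegral_Ioc_add (hv : ∀ i, IsExpFlow t (v i)) (hy : ∀ i, 0 ≤ y i) {τ : ℝ}
    (hτ : 0 ≤ τ) (hτt : τ ≤ t) :
    (∫⁻ s in Set.Ioc 0 τ, ENNReal.ofReal (Real.exp (-(s * ∑ k, y k)) *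
        (Real.exp (∑ i, y i * v i (τ - s)) * ∑ j, y j / (1 - v j (τ - s))))) +
        ENNReal.ofReal (Real.exp (-(τ * ∑ k, y k)) * Real.exp (∑ i, y i * v i 0)) =
      ENNReal.ofReal (Real.exp (∑ i, y i * v i τ)) := by
  have hφ : Continuous fun s => Real.exp (∑ i, y i * v i s) := by
    have := fun i => (hv i).continuous
    fun_prop
  have hψ : Continuous fun s => Real.exp (∑ i, y i * v i s) * ∑ j, y j / (1 - v j s) :=
    hφ.mul (continuous_sum_div hv y)
  have hcont : Continuous fun s => Real.exp (-(s * ∑ k, y k)) *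
      (Real.exp (∑ i, y i * v i (τ - s)) * ∑ j, y j / (1 - v j (τ - s))) :=
    Continuous.mul (by fun_prop) (hψ.comp (continuous_sub_left τ))
  have hnonneg (s : ℝ) : 0 ≤ Real.exp (-(s * ∑ k, y k)) *
      (Real.exp (∑ i, y i * v i (τ - s)) * ∑ j, y j / (1 - v j (τ - s))) := by
    have hsum : 0 ≤ ∑ j, y j / (1 - v j (τ - s)) := Finset.sum_nonneg fun j _ =>
      div_nonneg (hy j) (sub_pos.mpr ((hv j).lt_one _)).le
    positivity
  rw [← ofReal_integral_eq_lintegral_ofReal (μ := volume.restrict (Set.Ioc 0 τ))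
      (hcont.integrableOn_Icc.mono_set Set.Ioc_subset_Icc_self) (ae_of_all _ hnonneg),
    ← ENNReal.ofReal_add (integral_nonneg hnonneg) (by positivity),
    ← intervalIntegral.integral_of_le hτ,
    integral_exp_neg_mul_comp_const_sub hτ hφ.continuousOn hψ.continuousOn fun s hs =>
      hasDerivAt_exp_sum hv y ⟨hs.1, hs.2.trans_le hτt⟩, sub_add_cancel]

/-- With time `τ` left, `exp (∑ i, y i * v i τ)` is preserved on average by running the walk from
`y` either to its next renewal or to the end. -/
theorem lintegral_renewalKernel (hv : ∀ i, IsExpFlow t (v i)) (hy : ∀ i, 0 ≤ y i)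
    (hS : 0 < ∑ k, y k) {τ : ℝ} (hτ : 0 ≤ τ) (hτt : τ ≤ t) :
    ∫⁻ z, (if τ < z.1 then ENNReal.ofReal (Real.exp (∑ i, y i * v i 0))
        else ENNReal.ofReal (Real.exp (∑ i, (y + z.2.2 z.2.1) i * v i (τ - z.1))))
          ∂ContinuumPolyaWalk.renewalKernel (expDiagonalLaw c) y =
      ENNReal.ofReal (Real.exp (∑ i, y i * v i τ)) := by
  have hvm (i : Fin c) : Measurable (v i) := (hv i).continuous.measurable
  have hmeas : Measurable fun z : ℝ × Fin c × Matrix (Fin c) (Fin c) ℝ =>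
      if τ < z.1 then ENNReal.ofReal (Real.exp (∑ i, y i * v i 0))
        else ENNReal.ofReal (Real.exp (∑ i, (y + z.2.2 z.2.1) i * v i (τ - z.1))) :=
    Measurable.ite (measurableSet_lt measurable_const measurable_fst) measurable_const
      (measurable_ofReal_exp_sum_mul
        (ContinuumPolyaWalk.measurable_add_row.comp measurable_prodMk_left)
        (measurable_pi_lambda _ fun i => (hvm i).comp (measurable_const.sub measurable_fst)))
  rw [ContinuumPolyaWalk.lintegral_renewalKernel _ y hmeas, ← Set.Ioc_union_Ioi_eq_Ioi hτ,
    lintegral_union measurableSet_Ioi (Set.Ioc_disjoint_Ioi le_rfl),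
    ← setLIntegral_Ioc_add hv hy hτ hτt]
  congr 1
  · refine setLIntegral_congr_fun measurableSet_Ioc fun s hs => ?_
    simp only [if_neg (not_lt.mpr hs.2)]
    exact sum_mul_lintegral_exp_sum_add_row hy (fun i => (hv i).lt_one _) (Real.exp_pos _).le
  · set E := Real.exp (∑ i, y i * v i 0)
    have hstay := lintegral_Ioi_mul_exp_neg (q := (∑ k, y k) * E) (a := τ) (by positivity) hS
    rw [mul_div_cancel_left₀ _ hS.ne'] at hstay
    rw [← hstay]
    refine setLIntegral_congr_fun measurableSet_Ioi fun s hs => ?_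
    simp only [if_pos (Set.mem_Ioi.mp hs), lintegral_const, measure_univ, mul_one]
    rw [← Finset.sum_mul, ← ENNReal.ofReal_sum_of_nonneg fun j _ =>
      mul_nonneg (hy j) (Real.exp_pos _).le, ← Finset.sum_mul,
      ← ENNReal.ofReal_mul (mul_nonneg hS.le (Real.exp_pos _).le), mul_right_comm]

end IsExpFlow

namespace ContinuumPolyaWalk

variable {Ω : Type*} [MeasurableSpace Ω] {P : Measure Ω} {c : ℕ}
  {ν : Measure (Matrix (Fin c) (Fin c) ℝ)} {x : Fin c → ℝ}

section Moments

variable (w : ContinuumPolyaWalk P ν x) (v : Fin c → ℝ → ℝ) (a : Fin c → ℝ) (t : ℝ) (n : ℕ)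

/-- The event that the walk has made exactly `n` renewals at time `t`, provided the renewal times
increase. -/
def exactlyRenewals : Set Ω := {ω | w.renewalTime n ω ≤ t ∧ t < w.renewalTime (n + 1) ω}

/-- The exponential moment of the walk stopped at time `t`, on the event that there have been
exactly `n` renewals. -/
noncomputable def stoppedMoment : ℝ≥0∞ :=
  ∫⁻ ω in w.exactlyRenewals t n, ENNReal.ofReal (Real.exp (∑ i, w.pos n ω i * a i)) ∂P

/-- The exponential moment of the walk at its `n`-th renewal, on the event that this happens before
time `t`, with exponents given by the flow `v` at the time that remains until `t`. -/
noncomputable def runningMoment : ℝ≥0∞ :=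
  ∫⁻ ω in {ω | w.renewalTime n ω ≤ t},
    ENNReal.ofReal (Real.exp (∑ i, w.pos n ω i * v i (t - w.renewalTime n ω))) ∂P

/-- The exponential moment contributed by the renewal `q.2` that follows the past
`q.1 = (T, Y)`: the stopped one if this renewal happens after time `t`, the running one
otherwise. -/
noncomputable def stepMoment
    (q : (ℝ × (Fin c → ℝ)) × (ℝ × Fin c × Matrix (Fin c) (Fin c) ℝ)) : ℝ≥0∞ :=
  if q.1.1 ≤ t then
    if t - q.1.1 < q.2.1 then ENNReal.ofReal (Real.exp (∑ i, q.1.2 i * v i 0))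
    else ENNReal.ofReal
      (Real.exp (∑ i, (q.1.2 + q.2.2.2 q.2.2.1) i * v i (t - q.1.1 - q.2.1)))
  else 0

variable {v} in
theorem measurable_stepMoment (hv : ∀ i, Measurable (v i)) : Measurable (stepMoment v t) := by
  refine .ite (measurableSet_le (by fun_prop) measurable_const)
    (.ite (measurableSet_lt (by fun_prop) (by fun_prop)) (by fun_prop) ?_) measurable_const
  exact measurable_ofReal_exp_sum_mul
    (measurable_add_row.comp ((measurable_snd.comp measurable_fst).prodMk measurable_snd))
    (measurable_pi_lambda _ fun i => (hv i).comp (by fun_prop))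

theorem measurableSet_renewalTime_le : MeasurableSet {ω | w.renewalTime n ω ≤ t} :=
  measurableSet_le (w.measurable_renewalTime n) measurable_const

theorem measurableSet_exactlyRenewals : MeasurableSet (w.exactlyRenewals t n) :=
  (w.measurableSet_renewalTime_le t n).inter
    (measurableSet_lt measurable_const (w.measurable_renewalTime (n + 1)))

theorem stepMoment_renewal {ω : Ω} (hω : 0 < w.wait n ω) :
    stepMoment v t ((w.renewalTime n ω, w.pos n ω), w.renewal n ω) =
      (w.exactlyRenewals t n).indicator
        (fun ω => ENNReal.ofReal (Real.exp (∑ i, w.pos n ω i * v i 0))) ω +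
      {ω | w.renewalTime (n + 1) ω ≤ t}.indicator (fun ω => ENNReal.ofReal
        (Real.exp (∑ i, w.pos (n + 1) ω i * v i (t - w.renewalTime (n + 1) ω)))) ω := by
  simp only [stepMoment, renewal, exactlyRenewals, Set.indicator, Set.mem_ofPred_eq,
    renewalTime_succ, pos_succ, sub_sub, sub_lt_iff_lt_add']
  by_cases hT : w.renewalTime n ω ≤ t
  · by_cases hlt : t < w.renewalTime n ω + w.wait n ω
    · simp [hT, hlt, hlt.not_ge]
    · simp [hT, hlt, not_lt.mp hlt]
  · simp [hT, (lt_add_of_pos_right _ hω).trans' (not_le.mp hT)]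

end Moments

theorem strictMono_renewalTime {w : ContinuumPolyaWalk P ν x} {ω : Ω} (hω : ∀ n, 0 < w.wait n ω) :
    StrictMono fun n => w.renewalTime n ω :=
  strictMono_nat_of_lt_succ fun n => by
    rw [renewalTime_succ]
    exact lt_add_of_pos_right _ (hω n)

theorem renewalTime_nonneg {w : ContinuumPolyaWalk P ν x} {ω : Ω} (hω : ∀ n, 0 < w.wait n ω)
    (n : ℕ) : 0 ≤ w.renewalTime n ω :=
  Finset.sum_nonneg fun k _ => (hω k).le

theorem renewalCount_eq_of_mem_exactlyRenewals {w : ContinuumPolyaWalk P ν x} {ω : Ω}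
    (hω : ∀ n, 0 < w.wait n ω) {t : ℝ} {n : ℕ} (h : ω ∈ w.exactlyRenewals t n) :
    w.renewalCount t ω = n := by
  have hmono := strictMono_renewalTime hω
  have hset : {k : ℕ | w.renewalTime (k + 1) ω ≤ t} = Set.Iio n := by
    ext k
    exact ⟨fun hk => Nat.succ_lt_succ_iff.mp (hmono.lt_iff_lt.mp (hk.trans_lt h.2)),
      fun hk => (hmono.monotone (Nat.succ_le_of_lt hk)).trans h.1⟩
  rw [renewalCount, hset]
  simp [Set.ncard_eq_toFinset_card']

namespace StaysInOrthant

variable [IsProbabilityMeasure P] {w : ContinuumPolyaWalk P (expDiagonalLaw c) x}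
  {t : ℝ} {v v' : Fin c → ℝ → ℝ}

theorem stoppedMoment_add_runningMoment_succ (hw : w.StaysInOrthant)
    (hv : ∀ i, IsExpFlow t (v i)) (n : ℕ) :
    w.stoppedMoment (fun i => v i 0) t n + w.runningMoment v t (n + 1) =
      w.runningMoment v t n := by
  have hvm (i : Fin c) : Measurable (v i) := (hv i).continuous.measurable
  calc w.stoppedMoment (fun i => v i 0) t n + w.runningMoment v t (n + 1)
    _ = ∫⁻ ω, stepMoment v t ((w.renewalTime n ω, w.pos n ω), w.renewal n ω) ∂P := by
      rw [stoppedMoment, runningMoment, ← lintegral_indicator (w.measurableSet_exactlyRenewals t n),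
        ← lintegral_indicator (w.measurableSet_renewalTime_le t (n + 1)), ← lintegral_add_left
          (Measurable.indicator (by fun_prop) (w.measurableSet_exactlyRenewals t n))]
      refine lintegral_congr_ae ?_
      filter_upwards [hw.ae_wait_pos n] with ω hω
      exact (w.stepMoment_renewal v t n hω).symm
    _ = ∫⁻ ω, ∫⁻ z, stepMoment v t ((w.renewalTime n ω, w.pos n ω), z)
          ∂renewalKernel (expDiagonalLaw c) (w.pos n ω) ∂P :=
      hw.lintegral_past_renewal n (measurable_stepMoment t hvm)
    _ = w.runningMoment v t n := by
      rw [runningMoment, ← lintegral_indicator (w.measurableSet_renewalTime_le t n)]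
      refine lintegral_congr_ae ?_
      filter_upwards [ae_all_iff.mpr hw.ae_wait_pos, hw n] with ω hω ⟨hnonneg, hpos⟩
      simp only [stepMoment, Set.indicator, Set.mem_ofPred_eq]
      split_ifs with hT
      · exact IsExpFlow.lintegral_renewalKernel hv hnonneg hpos (sub_nonneg.mpr hT)
          (sub_le_self t (renewalTime_nonneg hω n))
      · exact lintegral_zero

theorem sum_stoppedMoment_add_runningMoment (hw : w.StaysInOrthant) (ht : 0 ≤ t)
    (hv : ∀ i, IsExpFlow t (v i)) (n : ℕ) :
    ∑ k ∈ Finset.range n, w.stoppedMoment (fun i => v i 0) t k + w.runningMoment v t n =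
      ENNReal.ofReal (Real.exp (∑ i, x i * v i t)) := by
  induction n with
  | zero => simp [runningMoment, renewalTime, pos, positionAfter, ht]
  | succ n ih => rw [Finset.sum_range_succ, add_assoc,
      hw.stoppedMoment_add_runningMoment_succ hv, ih]

/-- Hölder's inequality: the running moment along `v` interpolates between the one along `v'`, which
is bounded, and `E exp (-|Y n|) = exp (-|x|) / 2 ^ n`. -/
theorem runningMoment_le (hw : w.StaysInOrthant) (ht : 0 ≤ t)
    (hv' : ∀ i, IsExpFlow t (v' i)) {θ : ℝ} (hθ0 : 0 ≤ θ) (hθ1 : θ ≤ 1)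
    (hdom : ∀ i s, v i s ≤ v' i s * θ + -1 * (1 - θ)) (n : ℕ) :
    w.runningMoment v t n ≤ ENNReal.ofReal (Real.exp (∑ i, x i * v' i t)) ^ θ *
      (ENNReal.ofReal (1 / (1 - -1)) ^ n * ENNReal.ofReal (Real.exp (∑ i, x i * -1))) ^
        (1 - θ) := by
  have hv'm (i : Fin c) : Measurable (v' i) := (hv' i).continuous.measurable
  calc w.runningMoment v t n
    _ ≤ ∫⁻ ω in {ω | w.renewalTime n ω ≤ t},
          ENNReal.ofReal (Real.exp (∑ i, w.pos n ω i * v' i (t - w.renewalTime n ω))) ^ θ *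
          ENNReal.ofReal (Real.exp (∑ i, w.pos n ω i * -1)) ^ (1 - θ) ∂P := by
      refine lintegral_mono_ae (ae_restrict_of_ae ?_)
      filter_upwards [hw n] with ω ⟨hnonneg, _⟩
      rw [ENNReal.ofReal_rpow_of_pos (Real.exp_pos _), ENNReal.ofReal_rpow_of_pos (Real.exp_pos _),
        ← ENNReal.ofReal_mul (by positivity), ← Real.exp_mul, ← Real.exp_mul, ← Real.exp_add,
        Finset.sum_mul, Finset.sum_mul, ← Finset.sum_add_distrib]
      gcongr with i
      rw [mul_assoc, mul_assoc, ← mul_add]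
      exact mul_le_mul_of_nonneg_left (hdom i _) (hnonneg i)
    _ ≤ w.runningMoment v' t n ^ θ * (∫⁻ ω in {ω | w.renewalTime n ω ≤ t},
          ENNReal.ofReal (Real.exp (∑ i, w.pos n ω i * -1)) ∂P) ^ (1 - θ) :=
      ENNReal.lintegral_mul_norm_pow_le (by fun_prop) (by fun_prop) hθ0 (sub_nonneg.mpr hθ1)
        (add_sub_cancel _ _)
    _ ≤ _ := by
      have hrunning : w.runningMoment v' t n ≤ ENNReal.ofReal (Real.exp (∑ i, x i * v' i t)) := by
        rw [← hw.sum_stoppedMoment_add_runningMoment ht hv' n]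
        exact le_add_self
      have hpast := setLIntegral_le_lintegral (μ := P) {ω | w.renewalTime n ω ≤ t}
        fun ω => ENNReal.ofReal (Real.exp (∑ i, w.pos n ω i * -1))
      rw [hw.lintegral_exp_sum_pos (by norm_num) n] at hpast
      have := sub_nonneg.mpr hθ1
      gcongr

theorem tendsto_runningMoment (hw : w.StaysInOrthant) (ht : 0 ≤ t)
    (hv' : ∀ i, IsExpFlow t (v' i)) {θ : ℝ} (hθ0 : 0 ≤ θ) (hθ1 : θ < 1)
    (hdom : ∀ i s, v i s ≤ v' i s * θ + -1 * (1 - θ)) :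
    Tendsto (w.runningMoment v t) atTop (𝓝 0) := by
  have hgeom : Tendsto (fun n : ℕ => ENNReal.ofReal (1 / (1 - -1)) ^ n *
      ENNReal.ofReal (Real.exp (∑ i, x i * -1))) atTop (𝓝 0) := by
    have hhalf : ENNReal.ofReal (1 / (1 - -1)) < 1 := ENNReal.ofReal_lt_one.mpr (by norm_num)
    simpa using ENNReal.Tendsto.mul_const (ENNReal.tendsto_pow_atTop_nhds_zero_of_lt_one hhalf)
      (Or.inr ENNReal.ofReal_ne_top)
  have hpow := (ENNReal.continuous_rpow_const (y := 1 - θ)).tendsto' 0 0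
    (ENNReal.zero_rpow_of_pos (sub_pos.mpr hθ1))
  have hbound := ENNReal.Tendsto.const_mul (hpow.comp hgeom) (Or.inr
    (ENNReal.rpow_ne_top_of_nonneg hθ0
      (ENNReal.ofReal_ne_top (r := Real.exp (∑ i, x i * v' i t)))))
  rw [mul_zero] at hbound
  exact tendsto_of_tendsto_of_tendsto_of_le_of_le tendsto_const_nhds hbound
    (fun _ => zero_le) (hw.runningMoment_le ht hv' hθ0 hθ1.le hdom)

theorem tsum_stoppedMoment (hw : w.StaysInOrthant) (ht : 0 ≤ t) (hv : ∀ i, IsExpFlow t (v i))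
    (hv' : ∀ i, IsExpFlow t (v' i)) {θ : ℝ} (hθ0 : 0 ≤ θ) (hθ1 : θ < 1)
    (hdom : ∀ i s, v i s ≤ v' i s * θ + -1 * (1 - θ)) :
    ∑' n, w.stoppedMoment (fun i => v i 0) t n =
      ENNReal.ofReal (Real.exp (∑ i, x i * v i t)) := by
  have hsum := (ENNReal.summable (f := w.stoppedMoment (fun i => v i 0) t)).hasSum.tendsto_sum_nat
  have hrunning := hw.tendsto_runningMoment ht hv' hθ0 hθ1 hdom
  have hlim := hsum.add hrunning
  simp only [hw.sum_stoppedMoment_add_runningMoment ht hv, add_zero] at hlim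
  exact tendsto_nhds_unique hlim tendsto_const_nhds

end StaysInOrthant

end ContinuumPolyaWalk

section LambertW

theorem hasDerivAt_mul_exp (w : ℝ) :
    HasDerivAt (fun w : ℝ => w * Real.exp w) ((1 + w) * Real.exp w) w :=
  ((hasDerivAt_id w).mul (Real.hasDerivAt_exp w)).congr_deriv (by simp only [id]; ring)

theorem strictMonoOn_mul_exp : StrictMonoOn (fun w : ℝ => w * Real.exp w) (Set.Ici (-1)) := by
  refine strictMonoOn_of_deriv_pos (convex_Ici _) (by fun_prop) fun w hw => ?_
  rw [interior_Ici, Set.mem_Ioi] at hw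
  rw [(hasDerivAt_mul_exp w).deriv]
  exact mul_pos (by linarith) (Real.exp_pos _)

theorem exists_mul_exp_eq {z : ℝ} (hz : -Real.exp (-1) ≤ z) :
    ∃ w ∈ Set.Ici (-1 : ℝ), w * Real.exp w = z := by
  have hb : (-1 : ℝ) ≤ max z 0 := le_max_of_le_right (by norm_num)
  have hz' : z ≤ max z 0 * Real.exp (max z 0) := by
    have h1 : 1 ≤ Real.exp (max z 0) := Real.one_le_exp (le_max_right _ _)
    nlinarith [le_max_left z 0, le_max_right z 0]
  obtain ⟨w, hw, h⟩ := intermediate_value_Icc hb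
    (f := fun w : ℝ => w * Real.exp w) (by fun_prop) ⟨by simpa using hz, hz'⟩
  exact ⟨w, hw.1, h⟩

theorem neg_one_le_lambertW {z : ℝ} (hz : -Real.exp (-1) ≤ z) : -1 ≤ lambertW z :=
  Function.invFunOn_mem (exists_mul_exp_eq hz)

theorem lambertW_mul_exp {z : ℝ} (hz : -Real.exp (-1) ≤ z) :
    lambertW z * Real.exp (lambertW z) = z :=
  Function.invFunOn_eq (f := fun w : ℝ => w * Real.exp w) (exists_mul_exp_eq hz)

theorem neg_exp_neg_one_le_mul_exp {w : ℝ} (hw : -1 ≤ w) : -Real.exp (-1) ≤ w * Real.exp w := by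
  simpa using strictMonoOn_mul_exp.monotoneOn (Set.self_mem_Ici) hw hw

theorem lambertW_of_mul_exp {w : ℝ} (hw : -1 ≤ w) : lambertW (w * Real.exp w) = w := by
  have h := neg_exp_neg_one_le_mul_exp hw
  exact strictMonoOn_mul_exp.injOn (neg_one_le_lambertW h) hw (lambertW_mul_exp h)

theorem strictMonoOn_lambertW : StrictMonoOn lambertW (Set.Ici (-Real.exp (-1))) := by
  intro a ha b hb hab
  rw [← strictMonoOn_mul_exp.lt_iff_lt (neg_one_le_lambertW ha) (neg_one_le_lambertW hb)]
  simpa only [lambertW_mul_exp ha, lambertW_mul_exp hb] using hab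

theorem lambertW_image_Ici : lambertW '' Set.Ici (-Real.exp (-1)) = Set.Ici (-1) := by
  ext w
  constructor
  · rintro ⟨z, hz, rfl⟩
    exact neg_one_le_lambertW hz
  · exact fun hw => ⟨_, neg_exp_neg_one_le_mul_exp hw, lambertW_of_mul_exp hw⟩

theorem lambertW_neg_exp_neg_one : lambertW (-Real.exp (-1)) = -1 := by
  simpa using lambertW_of_mul_exp (w := -1) le_rfl

theorem neg_one_lt_lambertW {z : ℝ} (hz : -Real.exp (-1) < z) : -1 < lambertW z := by
  simpa only [lambertW_neg_exp_neg_one] using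
    strictMonoOn_lambertW Set.self_mem_Ici hz.le hz

theorem continuousAt_lambertW {z : ℝ} (hz : -Real.exp (-1) < z) : ContinuousAt lambertW z := by
  refine strictMonoOn_lambertW.continuousAt_of_image_mem_nhds (Ici_mem_nhds hz) ?_
  rw [lambertW_image_Ici]
  exact Ici_mem_nhds (neg_one_lt_lambertW hz)

theorem continuousOn_lambertW : ContinuousOn lambertW (Set.Ici (-Real.exp (-1))) := by
  intro z hz
  rcases eq_or_lt_of_le (Set.mem_Ici.mp hz) with h | h
  · subst h
    refine strictMonoOn_lambertW.continuousWithinAt_right_of_surjOn self_mem_nhdsWithin ?_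
    intro w hw
    rw [lambertW_neg_exp_neg_one] at hw
    rw [lambertW_image_Ici]
    exact (Set.mem_Ioi.mp hw).le
  · exact (continuousAt_lambertW h).continuousWithinAt

theorem hasDerivAt_lambertW {z : ℝ} (hz : -Real.exp (-1) < z) :
    HasDerivAt lambertW ((1 + lambertW z) * Real.exp (lambertW z))⁻¹ z := by
  have h := neg_one_lt_lambertW hz
  refine (hasDerivAt_mul_exp (lambertW z)).of_local_left_inverse (continuousAt_lambertW hz)
    (mul_pos (by linarith) (Real.exp_pos _)).ne' ?_
  filter_upwards [Ioi_mem_nhds hz] with y hy using lambertW_mul_exp (le_of_lt hy)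

end LambertW

section TreeFunction

variable {s : ℝ}

theorem continuousOn_treeFunction : ContinuousOn treeFunction (Set.Iic (Real.exp (-1))) :=
  (continuousOn_lambertW.comp (f := fun s => -s) continuous_neg.continuousOn
    fun _ hs => Set.mem_Ici.mpr (neg_le_neg hs)).neg

theorem strictMonoOn_treeFunction : StrictMonoOn treeFunction (Set.Iic (Real.exp (-1))) :=
  fun _ hr _ hs hrs =>
    neg_lt_neg (strictMonoOn_lambertW (Set.mem_Ici.mpr (neg_le_neg hs))
      (Set.mem_Ici.mpr (neg_le_neg hr)) (neg_lt_neg hrs))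

theorem treeFunction_mul_exp_neg (hs : s ≤ Real.exp (-1)) :
    treeFunction s * Real.exp (-treeFunction s) = s := by
  rw [treeFunction, neg_neg, neg_mul, lambertW_mul_exp (neg_le_neg hs), neg_neg]

theorem treeFunction_of_mul_exp_neg (hs : s ≤ 1) : treeFunction (s * Real.exp (-s)) = s := by
  rw [treeFunction, ← neg_mul, lambertW_of_mul_exp (neg_le_neg hs), neg_neg]

theorem treeFunction_zero : treeFunction 0 = 0 := by
  simpa only [zero_mul] using treeFunction_of_mul_exp_neg zero_le_one

theorem treeFunction_lt_one (hs : s < Real.exp (-1)) : treeFunction s < 1 :=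
  neg_lt.mp (neg_one_lt_lambertW (neg_lt_neg hs))

theorem hasDerivAt_treeFunction (hs : s < Real.exp (-1)) :
    HasDerivAt treeFunction ((1 - treeFunction s) * Real.exp (-treeFunction s))⁻¹ s := by
  refine ((hasDerivAt_lambertW (neg_lt_neg hs)).comp s (hasDerivAt_neg s)).neg.congr_deriv ?_
  simp only [treeFunction, sub_neg_eq_add, neg_neg, mul_neg_one]

theorem treeFunction_div_rpow (hs : s ≤ Real.exp (-1)) (hs0 : s ≠ 0) (r : ℝ) :
    (treeFunction s / s) ^ r = Real.exp (r * treeFunction s) := by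
  have hdiv : treeFunction s / s = Real.exp (treeFunction s) := by
    rw [div_eq_iff hs0, mul_comm, ← mul_inv_eq_iff_eq_mul₀ (Real.exp_ne_zero _), ← Real.exp_neg]
    exact treeFunction_mul_exp_neg hs
  rw [hdiv, ← Real.exp_mul, mul_comm]

end TreeFunction

section TreeFlow

theorem mul_exp_sub_lt_of_nonpos {u : ℝ} (hu : u ≤ 0) (t : ℝ) :
    u * Real.exp (t - u) < Real.exp (-1) :=
  (mul_nonpos_of_nonpos_of_nonneg hu (Real.exp_pos _).le).trans_lt (Real.exp_pos _)

theorem mul_exp_sub_lt_mul_exp_sub {u u' : ℝ} (huu' : u < u') (hu' : u' ≤ 1) (t : ℝ) :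
    u * Real.exp (t - u) < u' * Real.exp (t - u') := by
  have hmono : -u' * Real.exp (-u') < -u * Real.exp (-u) :=
    strictMonoOn_mul_exp (neg_le_neg hu') (neg_le_neg (huu'.le.trans hu')) (neg_lt_neg huu')
  rw [neg_mul, neg_mul, neg_lt_neg_iff] at hmono
  rw [sub_eq_neg_add, sub_eq_neg_add, Real.exp_add, Real.exp_add, ← mul_assoc, ← mul_assoc]
  exact mul_lt_mul_of_pos_right hmono (Real.exp_pos _)

/-- The solution `T(u e ^ (s - u))` of `v' = v / (1 - v)`, `v 0 = u`, on `[0, t]`, extended by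
constants. -/
noncomputable def treeFlow (t u s : ℝ) : ℝ :=
  treeFunction (u * Real.exp (max 0 (min t s) - u))

variable {t u : ℝ}

theorem mul_exp_clamp_sub_lt (ht : 0 ≤ t) (h : u * Real.exp (t - u) < Real.exp (-1)) (s : ℝ) :
    u * Real.exp (max 0 (min t s) - u) < Real.exp (-1) := by
  rcases le_total u 0 with hu | hu
  · exact mul_exp_sub_lt_of_nonpos hu _
  · refine lt_of_le_of_lt ?_ h
    gcongr
    exact max_le ht (min_le_left t s)

theorem treeFlow_clamp (t u s : ℝ) : treeFlow t u (max 0 (min t s)) = treeFlow t u s := by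
  rcases le_total 0 t with ht | ht
  · simp only [treeFlow, min_eq_right (max_le ht (min_le_left t s)), max_eq_right (le_max_left _ _)]
  · simp only [treeFlow, max_eq_left ((min_le_left t _).trans ht)]

theorem treeFlow_zero (hu : u ≤ 1) (t : ℝ) : treeFlow t u 0 = u := by
  rw [treeFlow, max_eq_left (min_le_right t 0), zero_sub, treeFunction_of_mul_exp_neg hu]

theorem treeFlow_self (ht : 0 ≤ t) (u : ℝ) :
    treeFlow t u t = treeFunction (u * Real.exp (t - u)) := by
  rw [treeFlow, min_self, max_eq_right ht]

theorem isExpFlow_treeFlow (ht : 0 ≤ t) (h : u * Real.exp (t - u) < Real.exp (-1)) :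
    IsExpFlow t (treeFlow t u) where
  continuous := continuousOn_treeFunction.comp_continuous (by fun_prop) fun s =>
    (mul_exp_clamp_sub_lt ht h s).le
  lt_one s := treeFunction_lt_one (mul_exp_clamp_sub_lt ht h s)
  hasDerivAt s hs := by
    have hclamp : ∀ r ∈ Set.Ioo 0 t, treeFlow t u r = treeFunction (u * Real.exp (r - u)) :=
      fun r hr => by rw [treeFlow, min_eq_right hr.2.le, max_eq_right hr.1.le]
    have hlt := mul_exp_clamp_sub_lt ht h s
    rw [min_eq_right hs.2.le, max_eq_right hs.1.le] at hlt
    have harg : HasDerivAt (fun r => u * Real.exp (r - u)) (u * Real.exp (s - u)) s := by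
      simpa using ((hasDerivAt_id s).sub_const u).exp.const_mul u
    have hlt_one := treeFunction_lt_one hlt
    have hinv := treeFunction_mul_exp_neg hlt.le
    refine HasDerivAt.congr_of_eventuallyEq ?_
      (Set.EqOn.eventuallyEq_of_mem hclamp (isOpen_Ioo.mem_nhds hs))
    refine ((hasDerivAt_treeFunction hlt).comp s harg).congr_deriv ?_
    rw [hclamp s hs]
    generalize treeFunction (u * Real.exp (s - u)) = T at hinv hlt_one ⊢
    have hne : 1 - T ≠ 0 := (sub_pos.mpr hlt_one).ne'
    rw [← hinv]
    field_simp [Real.exp_ne_zero]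

theorem treeFlow_lt {u' : ℝ} (ht : 0 ≤ t) (huu' : u < u') (hu' : u' ≤ 1)
    (h : u * Real.exp (t - u) < Real.exp (-1)) (h' : u' * Real.exp (t - u') < Real.exp (-1))
    (s : ℝ) : treeFlow t u s < treeFlow t u' s :=
  strictMonoOn_treeFunction (mul_exp_clamp_sub_lt ht h s).le (mul_exp_clamp_sub_lt ht h' s).le
    (mul_exp_sub_lt_mul_exp_sub huu' hu' _)

theorem exists_treeFlow_add_le (ht : 0 ≤ t) (hu : u < 1)
    (h : u * Real.exp (t - u) < Real.exp (-1)) :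
    ∃ u' : ℝ, u' * Real.exp (t - u') < Real.exp (-1) ∧
      ∃ δ > 0, ∀ s, treeFlow t u s + δ ≤ treeFlow t u' s := by
  have hcont : Continuous fun r : ℝ => r * Real.exp (t - r) := by fun_prop
  have hsub : ∀ᶠ r in 𝓝[>] u, r * Real.exp (t - r) < Real.exp (-1) :=
    ((hcont.tendsto u).mono_left nhdsWithin_le_nhds).eventually_lt_const h
  obtain ⟨u', h', hu'⟩ := (hsub.and (Ioo_mem_nhdsGT hu)).exists
  have hgap : Continuous fun s => treeFlow t u' s - treeFlow t u s :=
    (isExpFlow_treeFlow ht h').continuous.sub (isExpFlow_treeFlow ht h).continuous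
  obtain ⟨s₀, -, hmin⟩ := isCompact_Icc.exists_isMinOn (Set.nonempty_Icc.mpr ht) hgap.continuousOn
  refine ⟨u', h', _, sub_pos.mpr (treeFlow_lt ht hu'.1 hu'.2.le h h' s₀), fun s => ?_⟩
  have hs : max 0 (min t s) ∈ Set.Icc 0 t := ⟨le_max_left _ _, max_le ht (min_le_left _ _)⟩
  have hle := isMinOn_iff.mp hmin _ hs
  rw [treeFlow_clamp, treeFlow_clamp] at hle
  linarith

end TreeFlow

theorem integrable_and_integral_eq_of_lintegral_eq {Ω : Type*} [MeasurableSpace Ω] {P : Measure Ω}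
    {f : Ω → ℝ} {a : ℝ} (hf : AEStronglyMeasurable f P) (hf0 : 0 ≤ f) (ha : 0 ≤ a)
    (h : ∫⁻ ω, ENNReal.ofReal (f ω) ∂P = ENNReal.ofReal a) :
    Integrable f P ∧ ∫ ω, f ω ∂P = a := by
  refine ⟨?_, ?_⟩
  · rw [← lintegral_ofReal_ne_top_iff_integrable hf (ae_of_all _ hf0), h]
    exact ENNReal.ofReal_ne_top
  · rw [integral_eq_lintegral_of_nonneg_ae (ae_of_all _ hf0) hf, h, ENNReal.toReal_ofReal ha]

theorem integrable_and_integral_le_of_tendsto {Ω κ : Type*} [MeasurableSpace Ω] {P : Measure Ω}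
    {l : Filter κ} [l.NeBot] [l.IsCountablyGenerated] {f : κ → Ω → ℝ} {g : Ω → ℝ} {b : κ → ℝ}
    {B : ℝ} (hf : ∀ k, AEMeasurable (f k) P) (hf0 : ∀ k, 0 ≤ f k) (hg : AEMeasurable g P)
    (hint : ∀ᶠ k in l, Integrable (f k) P) (hfg : ∀ ω, Tendsto (f · ω) l (𝓝 (g ω)))
    (hle : ∀ᶠ k in l, ∫ ω, f k ω ∂P ≤ b k) (hb : Tendsto b l (𝓝 B)) :
    Integrable g P ∧ ∫ ω, g ω ∂P ≤ B := by
  have hg0 : 0 ≤ g := fun ω => ge_of_tendsto' (hfg ω) fun k => hf0 k ω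
  have hB : 0 ≤ B := ge_of_tendsto hb (hle.mono fun k hk => (integral_nonneg (hf0 k)).trans hk)
  have hlint : ∫⁻ ω, ENNReal.ofReal (g ω) ∂P ≤ ENNReal.ofReal B :=
    calc ∫⁻ ω, ENNReal.ofReal (g ω) ∂P
        = ∫⁻ ω, liminf (fun k => ENNReal.ofReal (f k ω)) l ∂P :=
          lintegral_congr fun ω => (ENNReal.tendsto_ofReal (hfg ω)).liminf_eq.symm
      _ ≤ liminf (fun k => ∫⁻ ω, ENNReal.ofReal (f k ω) ∂P) l :=
          lintegral_liminf_le' fun k => (hf k).ennreal_ofReal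
      _ ≤ liminf (fun k => ENNReal.ofReal (b k)) l := by
          refine liminf_le_liminf ?_
          filter_upwards [hint, hle] with k hk hkb
          rw [← ofReal_integral_eq_lintegral_ofReal hk (ae_of_all _ (hf0 k))]
          exact ENNReal.ofReal_le_ofReal hkb
      _ = ENNReal.ofReal B := (ENNReal.tendsto_ofReal hb).liminf_eq
  have hgint : Integrable g P :=
    (lintegral_ofReal_ne_top_iff_integrable hg.aestronglyMeasurable (ae_of_all _ hg0)).mp
      (ne_top_of_le_ne_top ENNReal.ofReal_ne_top hlint)
  rw [← ofReal_integral_eq_lintegral_ofReal hgint (ae_of_all _ hg0)] at hlint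
  exact ⟨hgint, (ENNReal.ofReal_le_ofReal_iff hB).mp hlint⟩

/-- Fatou's lemma as `r` increases to `u` gives integrability; dominated convergence, with
`exp ((u - 1) * Y) + exp (u * Y)` as the dominating function, then gives the value. -/
theorem integrable_and_mgf_eq_of_continuousWithinAt {Ω : Type*} [MeasurableSpace Ω]
    {P : Measure Ω} {Y : Ω → ℝ} {g : ℝ → ℝ} {u : ℝ} (hY : AEMeasurable Y P)
    (h : ∀ r < u, Integrable (fun ω => Real.exp (r * Y ω)) P ∧ mgf Y P r = g r)
    (hg : ContinuousWithinAt g (Set.Iio u) u) :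
    Integrable (fun ω => Real.exp (u * Y ω)) P ∧ mgf Y P u = g u := by
  have hexp (ω : Ω) : Tendsto (fun r => Real.exp (r * Y ω)) (𝓝[<] u) (𝓝 (Real.exp (u * Y ω))) :=
    (Continuous.tendsto (by fun_prop) u).mono_left nhdsWithin_le_nhds
  have hmgf : Tendsto (mgf Y P) (𝓝[<] u) (𝓝 (g u)) :=
    hg.congr' (eventually_mem_nhdsWithin.mono fun r hr => (h r hr).2.symm)
  have hint : Integrable (fun ω => Real.exp (u * Y ω)) P :=
    (integrable_and_integral_le_of_tendsto (l := 𝓝[<] u) (fun r => by fun_prop)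
      (fun _ _ => (Real.exp_pos _).le) (by fun_prop)
      (eventually_mem_nhdsWithin.mono fun r hr => (h r hr).1) hexp
      (.of_forall fun _ => le_rfl) hmgf).1
  refine ⟨hint, tendsto_nhds_unique (tendsto_integral_filter_of_dominated_convergence
    (fun ω => Real.exp ((u - 1) * Y ω) + Real.exp (u * Y ω)) (.of_forall fun r => by fun_prop) ?_
    ((h _ (sub_one_lt u)).1.add hint) (ae_of_all _ hexp)) hmgf⟩
  filter_upwards [Ioo_mem_nhdsLT (sub_one_lt u)] with r hr
  refine ae_of_all _ fun ω => ?_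
  rw [Real.norm_eq_abs, Real.abs_exp]
  rcases le_total 0 (Y ω) with hω | hω
  · refine le_add_of_nonneg_of_le (Real.exp_pos _).le (Real.exp_le_exp.mpr ?_)
    exact mul_le_mul_of_nonneg_right hr.2.le hω
  · refine le_add_of_le_of_nonneg (Real.exp_le_exp.mpr ?_) (Real.exp_pos _).le
    exact mul_le_mul_of_nonpos_right hr.1.le hω

section Scaling

variable {s : ℝ}

theorem mul_exp_neg_mul_le_self {a : ℝ} (ha : 0 ≤ a) (s : ℝ) : s * Real.exp (-(a * s)) ≤ s := by
  rcases le_total 0 s with hs | hs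
  · exact mul_le_of_le_one_right hs (Real.exp_le_one_iff.mpr (neg_nonpos.mpr (mul_nonneg ha hs)))
  · exact mul_le_of_one_le_right hs
      (Real.one_le_exp (neg_nonneg.mpr (mul_nonpos_of_nonneg_of_nonpos ha hs)))

theorem exp_neg_mul_mul_exp_sub (t s : ℝ) :
    Real.exp (-t) * s * Real.exp (t - Real.exp (-t) * s) =
      s * Real.exp (-(Real.exp (-t) * s)) := by
  rw [sub_eq_add_neg, Real.exp_add, Real.exp_neg t]
  field_simp

theorem exp_neg_mul_lt_one {t : ℝ} (ht : 0 ≤ t) (hs : s ≤ Real.exp (-1)) :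
    Real.exp (-t) * s < 1 := by
  have hs1 : s < 1 := hs.trans_lt (Real.exp_lt_one_iff.mpr (by norm_num))
  nlinarith [Real.exp_pos (-t), Real.exp_le_one_iff.mpr (neg_nonpos.mpr ht)]

theorem tendsto_treeFunction_mul_exp_neg (hs : s ≤ Real.exp (-1)) :
    Tendsto (fun t => treeFunction (s * Real.exp (-(Real.exp (-t) * s)))) atTop
      (𝓝 (treeFunction s)) := by
  have harg : Tendsto (fun t => s * Real.exp (-(Real.exp (-t) * s))) atTop (𝓝 s) := by
    simpa using (((Real.tendsto_exp_neg_atTop_nhds_zero.mul_const s).neg).rexp).const_mul s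
  exact (continuousOn_treeFunction s hs).tendsto.comp (tendsto_nhdsWithin_iff.mpr ⟨harg,
    .of_forall fun t => (mul_exp_neg_mul_le_self (Real.exp_pos _).le s).trans hs⟩)

end Scaling

namespace ContinuumPolyaWalk

section RenewalCount

variable {Ω : Type*} [MeasurableSpace Ω] {P : Measure Ω} {c : ℕ}
  {ν : Measure (Matrix (Fin c) (Fin c) ℝ)} {x : Fin c → ℝ} {w : ContinuumPolyaWalk P ν x}
  {ω : Ω} {t : ℝ}

theorem X_eq_pos_of_mem_exactlyRenewals (hω : ∀ n, 0 < w.wait n ω) {n : ℕ}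
    (h : ω ∈ w.exactlyRenewals t n) : w.X t ω = w.pos n ω := by
  rw [X, renewalCount_eq_of_mem_exactlyRenewals hω h]

theorem X_of_neg (hω : ∀ n, 0 < w.wait n ω) (ht : t < 0) : w.X t ω = x := by
  have hempty : {n : ℕ | w.renewalTime (n + 1) ω ≤ t} = ∅ :=
    Set.eq_empty_of_forall_notMem fun n hn => (ht.trans_le (renewalTime_nonneg hω _)).not_ge hn
  rw [X, renewalCount, hempty, Set.ncard_empty, positionAfter]

end RenewalCount

namespace StaysInOrthant

variable {Ω : Type*} [MeasurableSpace Ω] {P : Measure Ω} [IsProbabilityMeasure P] {c : ℕ}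
  {x : Fin c → ℝ} {w : ContinuumPolyaWalk P (expDiagonalLaw c) x} {t : ℝ} {u : Fin c → ℝ}

theorem tsum_stoppedMoment_treeFlow (hw : w.StaysInOrthant) (ht : 0 ≤ t) (hu : ∀ i, u i < 1)
    (h : ∀ i, u i * Real.exp (t - u i) < Real.exp (-1)) :
    ∑' n, w.stoppedMoment u t n = ENNReal.ofReal
      (Real.exp (∑ i, x i * treeFunction (u i * Real.exp (t - u i)))) := by
  choose u' h' δ hδ hgap using fun i => exists_treeFlow_add_le ht (hu i) (h i)
  have hsmall : ∀ᶠ d in 𝓝[>] (0 : ℝ), d ≤ 1 ∧ ∀ i, d ≤ δ i :=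
    nhdsWithin_le_nhds ((eventually_le_nhds one_pos).and
      (eventually_all.mpr fun i => eventually_le_nhds (hδ i)))
  obtain ⟨d, ⟨hd1, hd⟩, (hd0 : 0 < d)⟩ :=
    (hsmall.and self_mem_nhdsWithin).exists
  have hdom (i : Fin c) (s : ℝ) :
      treeFlow t (u i) s ≤ treeFlow t (u' i) s * (1 - d / 2) + -1 * (1 - (1 - d / 2)) := by
    have hlt := (isExpFlow_treeFlow ht (h' i)).lt_one s
    nlinarith [hgap i s, hd i, hd0]
  have hsum := hw.tsum_stoppedMoment ht (fun i => isExpFlow_treeFlow ht (h i))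
    (fun i => isExpFlow_treeFlow ht (h' i)) (by linarith) (by linarith) hdom
  simpa only [treeFlow_zero (hu _).le, treeFlow_self ht] using hsum

theorem aedisjoint_exactlyRenewals (hw : w.StaysInOrthant) (t : ℝ) :
    Pairwise (Function.onFun (AEDisjoint P) (w.exactlyRenewals t)) := by
  intro m n hmn
  refine measure_mono_null ?_ (ae_iff.mp (ae_all_iff.mpr hw.ae_wait_pos))
  rintro ω ⟨hm, hn⟩ (hω : ∀ n, 0 < w.wait n ω)
  apply hmn
  rw [← renewalCount_eq_of_mem_exactlyRenewals hω hm,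
    renewalCount_eq_of_mem_exactlyRenewals hω hn]

/-- The walk does not explode: this is the case `u = 0` of `tsum_stoppedMoment_treeFlow`. -/
theorem ae_mem_iUnion_exactlyRenewals (hw : w.StaysInOrthant) (ht : 0 ≤ t) :
    ∀ᵐ ω ∂P, ω ∈ ⋃ n, w.exactlyRenewals t n := by
  have hsum := hw.tsum_stoppedMoment_treeFlow ht (u := 0) (fun _ => one_pos)
    (fun _ => mul_exp_sub_lt_of_nonpos le_rfl t)
  simp only [stoppedMoment, Pi.zero_apply, mul_zero, Finset.sum_const_zero, Real.exp_zero,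
    ENNReal.ofReal_one, lintegral_const, Measure.restrict_apply_univ, one_mul, zero_mul,
    treeFunction_zero] at hsum
  rw [← measure_iUnion₀ (hw.aedisjoint_exactlyRenewals t)
    fun n => (w.measurableSet_exactlyRenewals t n).nullMeasurableSet] at hsum
  exact (prob_compl_eq_zero_iff (.iUnion (w.measurableSet_exactlyRenewals t))).mpr hsum

theorem restrict_iUnion_exactlyRenewals (hw : w.StaysInOrthant) (ht : 0 ≤ t) :
    P.restrict (⋃ n, w.exactlyRenewals t n) = P :=
  Measure.restrict_eq_self_of_ae_mem (hw.ae_mem_iUnion_exactlyRenewals ht)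

theorem aemeasurable_X (hw : w.StaysInOrthant) (t : ℝ) : AEMeasurable (w.X t) P := by
  have hpos := ae_all_iff.mpr hw.ae_wait_pos
  rcases le_or_gt 0 t with ht | ht
  · suffices h : AEMeasurable (w.X t) (P.restrict (⋃ n, w.exactlyRenewals t n)) by
      rwa [hw.restrict_iUnion_exactlyRenewals ht] at h
    refine aemeasurable_iUnion_iff.mpr fun n => (w.measurable_pos n).aemeasurable.congr ?_
    rw [EventuallyEq, ae_restrict_iff' (w.measurableSet_exactlyRenewals t n)]
    filter_upwards [hpos] with ω hω h
    exact (X_eq_pos_of_mem_exactlyRenewals hω h).symm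
  · refine (aemeasurable_const (b := x)).congr ?_
    filter_upwards [hpos] with ω hω
    exact (X_of_neg hω ht).symm

theorem lintegral_exp_sum_X (hw : w.StaysInOrthant) (ht : 0 ≤ t) (hu : ∀ i, u i < 1)
    (h : ∀ i, u i * Real.exp (t - u i) < Real.exp (-1)) :
    ∫⁻ ω, ENNReal.ofReal (Real.exp (∑ i, w.X t ω i * u i)) ∂P = ENNReal.ofReal
      (Real.exp (∑ i, x i * treeFunction (u i * Real.exp (t - u i)))) := by
  have hcover (f : Ω → ℝ≥0∞) : ∫⁻ ω, f ω ∂P = ∫⁻ ω in ⋃ n, w.exactlyRenewals t n, f ω ∂P := by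
    rw [hw.restrict_iUnion_exactlyRenewals ht]
  rw [← hw.tsum_stoppedMoment_treeFlow ht hu h, hcover,
    lintegral_iUnion₀ (fun n => (w.measurableSet_exactlyRenewals t n).nullMeasurableSet)
    (hw.aedisjoint_exactlyRenewals t)]
  refine tsum_congr fun n => setLIntegral_congr_fun_ae (w.measurableSet_exactlyRenewals t n) ?_
  filter_upwards [ae_all_iff.mpr hw.ae_wait_pos] with ω hω hmem
  rw [X_eq_pos_of_mem_exactlyRenewals hω hmem]

theorem integrable_and_integral_exp_sum_X (hw : w.StaysInOrthant) (ht : 0 ≤ t)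
    (hu : ∀ i, u i < 1) (h : ∀ i, u i * Real.exp (t - u i) < Real.exp (-1)) :
    Integrable (fun ω => Real.exp (∑ i, w.X t ω i * u i)) P ∧
      ∫ ω, Real.exp (∑ i, w.X t ω i * u i) ∂P =
        Real.exp (∑ i, x i * treeFunction (u i * Real.exp (t - u i))) := by
  have hX := hw.aemeasurable_X t
  exact integrable_and_integral_eq_of_lintegral_eq
    (AEMeasurable.aestronglyMeasurable (by fun_prop)) (fun _ => (Real.exp_pos _).le)
    (Real.exp_pos _).le (hw.lintegral_exp_sum_X ht hu h)

theorem integrable_and_mgf_X_apply_of_lt (hw : w.StaysInOrthant) (i : Fin c) {u : ℝ} (ht : 0 ≤ t)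
    (hu : u < 1) (h : u * Real.exp (t - u) < Real.exp (-1)) :
    Integrable (fun ω => Real.exp (u * w.X t ω i)) P ∧
      mgf (fun ω => w.X t ω i) P u = Real.exp (x i * treeFunction (u * Real.exp (t - u))) := by
  have hsingle (j : Fin c) (p : ℝ → Prop) (hp : p u) (hp0 : p 0) :
      p (Pi.single (M := fun _ => ℝ) i u j) := by
    rcases eq_or_ne j i with rfl | hj
    · rwa [Pi.single_eq_same]
    · rwa [Pi.single_eq_of_ne hj]
  have hjoint := hw.integrable_and_integral_exp_sum_X ht (u := Pi.single i u)
    (fun j => hsingle j (· < 1) hu one_pos)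
    (fun j => hsingle j (fun r => r * Real.exp (t - r) < Real.exp (-1)) h
      (mul_exp_sub_lt_of_nonpos le_rfl t))
  have hsum (y : Fin c → ℝ) (f : ℝ → ℝ) (hf : f 0 = 0) :
      ∑ j, y j * f (Pi.single (M := fun _ => ℝ) i u j) = y i * f u := by
    rw [Finset.sum_eq_single i (fun j _ hj => by rw [Pi.single_eq_of_ne hj, hf, mul_zero])
      (by simp), Pi.single_eq_same]
  simp only [hsum _ (fun r => treeFunction (r * Real.exp (t - r))) (by rw [zero_mul,
    treeFunction_zero]), hsum _ (fun r => r) rfl, mul_comm _ u] at hjoint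
  exact hjoint

theorem integrable_and_mgf_X_apply (hw : w.StaysInOrthant) (i : Fin c) {u : ℝ} (ht : 0 ≤ t)
    (hu : u < 1) (h : u * Real.exp (t - u) ≤ Real.exp (-1)) :
    Integrable (fun ω => Real.exp (u * w.X t ω i)) P ∧
      mgf (fun ω => w.X t ω i) P u = Real.exp (x i * treeFunction (u * Real.exp (t - u))) := by
  have hlt (r : ℝ) (hr : r < u) : r * Real.exp (t - r) < Real.exp (-1) :=
    (mul_exp_sub_lt_mul_exp_sub hr hu.le t).trans_le h
  refine integrable_and_mgf_eq_of_continuousWithinAt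
    (g := fun r => Real.exp (x i * treeFunction (r * Real.exp (t - r))))
    ((measurable_pi_apply i).comp_aemeasurable (hw.aemeasurable_X t))
    (fun r hr => hw.integrable_and_mgf_X_apply_of_lt i ht (hr.trans hu) (hlt r hr)) ?_
  have harg : ContinuousWithinAt (fun r : ℝ => r * Real.exp (t - r)) (Set.Iio u) u := by fun_prop
  exact (((continuousOn_treeFunction _ h).comp (f := fun r => r * Real.exp (t - r)) (x := u) harg
    fun r hr => (hlt r hr).le).const_mul _).rexp

section Scaling

variable {s : ℝ}

theorem integrable_and_mgf_exp_neg_mul_X_apply (hw : w.StaysInOrthant) (i : Fin c) (ht : 0 ≤ t)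
    (hs : s ≤ Real.exp (-1)) :
    Integrable (fun ω => Real.exp (s * (Real.exp (-t) * w.X t ω i))) P ∧
      mgf (fun ω => Real.exp (-t) * w.X t ω i) P s =
        Real.exp (x i * treeFunction (s * Real.exp (-(Real.exp (-t) * s)))) := by
  have h := hw.integrable_and_mgf_X_apply i ht (exp_neg_mul_lt_one ht hs)
    (by rw [exp_neg_mul_mul_exp_sub]
        exact (mul_exp_neg_mul_le_self (Real.exp_pos _).le s).trans hs)
  rw [exp_neg_mul_mul_exp_sub, ← mgf_const_mul] at h
  simpa only [mul_left_comm s, ← mul_assoc] using h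

theorem tendsto_mgf_exp_neg_mul_X_apply (hw : w.StaysInOrthant) (i : Fin c)
    (hs : s ≤ Real.exp (-1)) :
    Tendsto (fun t => mgf (fun ω => Real.exp (-t) * w.X t ω i) P s) atTop
      (𝓝 (Real.exp (x i * treeFunction s))) :=
  ((tendsto_treeFunction_mul_exp_neg hs).const_mul _).rexp.congr'
    ((eventually_ge_atTop 0).mono fun _ ht =>
      (hw.integrable_and_mgf_exp_neg_mul_X_apply i ht hs).2.symm)

theorem integrable_and_integral_exp_dotProduct_X {s : Fin c → ℝ} (hw : w.StaysInOrthant)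
    (ht : 0 ≤ t) (hs : ∀ i, s i < Real.exp (-1)) :
    Integrable (fun ω => Real.exp (s ⬝ᵥ Real.exp (-t) • w.X t ω)) P ∧
      ∫ ω, Real.exp (s ⬝ᵥ Real.exp (-t) • w.X t ω) ∂P =
        Real.exp (∑ i, x i * treeFunction (s i * Real.exp (-(Real.exp (-t) * s i)))) := by
  have h := hw.integrable_and_integral_exp_sum_X ht (u := fun i => Real.exp (-t) * s i)
    (fun i => exp_neg_mul_lt_one ht (hs i).le) (fun i => by
      rw [exp_neg_mul_mul_exp_sub]
      exact (mul_exp_neg_mul_le_self (Real.exp_pos _).le _).trans_lt (hs i))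
  have hdot (ω : Ω) : ∑ i, w.X t ω i * (Real.exp (-t) * s i) = s ⬝ᵥ Real.exp (-t) • w.X t ω :=
    Finset.sum_congr rfl fun i _ => by rw [Pi.smul_apply, smul_eq_mul]; ring
  simpa only [exp_neg_mul_mul_exp_sub, hdot] using h

theorem tendsto_integral_exp_dotProduct_X {s : Fin c → ℝ} (hw : w.StaysInOrthant)
    (hs : ∀ i, s i < Real.exp (-1)) :
    Tendsto (fun t => ∫ ω, Real.exp (s ⬝ᵥ Real.exp (-t) • w.X t ω) ∂P) atTop
      (𝓝 (Real.exp (∑ i, x i * treeFunction (s i)))) :=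
  (tendsto_finsetSum _ fun i _ =>
      (tendsto_treeFunction_mul_exp_neg (hs i).le).const_mul _).rexp.congr'
    ((eventually_ge_atTop 0).mono fun _ ht =>
      (hw.integrable_and_integral_exp_dotProduct_X ht hs).2.symm)

end Scaling

end StaysInOrthant

end ContinuumPolyaWalk

section WeakLimits

variable {E α : Type*} [TopologicalSpace E] [MeasurableSpace E] [OpensMeasurableSpace E]
  {l : Filter α} [l.NeBot] {μ : α → ProbabilityMeasure E} {ν : ProbabilityMeasure E}

theorem integrable_and_integral_le_of_tendsto_probabilityMeasure (hμ : Tendsto μ l (𝓝 ν))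
    {f : E → ℝ} {b : ℝ} (hf : Continuous f) (hf0 : 0 ≤ f)
    (hint : ∀ᶠ a in l, Integrable f (μ a : Measure E))
    (hb : Tendsto (fun a => ∫ z, f z ∂(μ a : Measure E)) l (𝓝 b)) :
    Integrable f (ν : Measure E) ∧ ∫ z, f z ∂(ν : Measure E) ≤ b := by
  have hmin0 (n : ℕ) (z : E) : 0 ≤ min (f z) n := le_min (hf0 z) n.cast_nonneg
  let trunc (n : ℕ) : E →ᵇ ℝ := .ofNormedAddCommGroup (fun z => min (f z) n) (by fun_prop) n
    fun z => by rw [Real.norm_of_nonneg (hmin0 n z)]; exact min_le_right _ _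
  have htrunc (n : ℕ) : ∫ z, trunc n z ∂(ν : Measure E) ≤ b := by
    refine le_of_tendsto_of_tendsto
      (ProbabilityMeasure.tendsto_iff_forall_integral_tendsto.mp hμ (trunc n)) hb ?_
    filter_upwards [hint] with a ha
    exact integral_mono ((trunc n).integrable _) ha fun z => min_le_left _ _
  refine integrable_and_integral_le_of_tendsto (l := atTop)
    (fun n => (trunc n).continuous.aemeasurable) hmin0 hf.aemeasurable
    (.of_forall fun n => (trunc n).integrable _) (fun z => ?_) (.of_forall htrunc)
    tendsto_const_nhds
  refine tendsto_const_nhds.congr' ?_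
  filter_upwards [eventually_ge_atTop ⌈f z⌉₊] with n hn
  exact (min_eq_left (Nat.ceil_le.mp hn)).symm

/-- The domination hypothesis makes `f` uniformly integrable along `μ`. The lower bound on the
integral of `f` comes from Fatou's lemma for the nonnegative function `ε * g + C - f`. -/
theorem integrable_and_integral_eq_of_tendsto_probabilityMeasure (hμ : Tendsto μ l (𝓝 ν))
    {f g : E → ℝ} {F G : ℝ} (hf : Continuous f) (hf0 : 0 ≤ f) (hg : Continuous g) (hg0 : 0 ≤ g)
    (hdom : ∀ ε > 0, ∃ C : ℝ, ∀ z, f z ≤ ε * g z + C)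
    (hfint : ∀ᶠ a in l, Integrable f (μ a : Measure E))
    (hgint : ∀ᶠ a in l, Integrable g (μ a : Measure E))
    (hF : Tendsto (fun a => ∫ z, f z ∂(μ a : Measure E)) l (𝓝 F))
    (hG : Tendsto (fun a => ∫ z, g z ∂(μ a : Measure E)) l (𝓝 G)) :
    Integrable f (ν : Measure E) ∧ ∫ z, f z ∂(ν : Measure E) = F := by
  obtain ⟨hf', hle⟩ :=
    integrable_and_integral_le_of_tendsto_probabilityMeasure hμ hf hf0 hfint hF
  have hg' := (integrable_and_integral_le_of_tendsto_probabilityMeasure hμ hg hg0 hgint hG).1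
  refine ⟨hf', hle.antisymm ?_⟩
  have hintegral (ε C : ℝ) {ρ : ProbabilityMeasure E} (hfρ : Integrable f (ρ : Measure E))
      (hgρ : Integrable g (ρ : Measure E)) :
      ∫ z, (ε * g z + C - f z) ∂(ρ : Measure E) =
        ε * ∫ z, g z ∂(ρ : Measure E) + C - ∫ z, f z ∂(ρ : Measure E) := by
    have hdomρ : Integrable (fun z => ε * g z + C) (ρ : Measure E) :=
      (hgρ.const_mul ε).add (integrable_const C)
    rw [integral_sub hdomρ hfρ,
      integral_add (hgρ.const_mul ε) (integrable_const C), integral_const_mul, integral_const,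
      probReal_univ, one_smul]
  have hlower (ε : ℝ) (hε : 0 < ε) :
      F ≤ ∫ z, f z ∂(ν : Measure E) + ε * (G - ∫ z, g z ∂(ν : Measure E)) := by
    obtain ⟨C, hC⟩ := hdom ε hε
    have hlim : Tendsto (fun a => ∫ z, (ε * g z + C - f z) ∂(μ a : Measure E)) l
        (𝓝 (ε * G + C - F)) := by
      refine (((hG.const_mul ε).add_const C).sub hF).congr' ?_
      filter_upwards [hfint, hgint] with a hfa hga using (hintegral ε C hfa hga).symm
    have hfatou := (integrable_and_integral_le_of_tendsto_probabilityMeasure hμ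
      (f := fun z => ε * g z + C - f z) (by fun_prop) (fun z => sub_nonneg.mpr (hC z))
      (by filter_upwards [hfint, hgint] with a hfa hga
          exact ((hga.const_mul ε).add (integrable_const C)).sub hfa) hlim).2
    rw [hintegral ε C hf' hg'] at hfatou
    linarith
  have hzero : Tendsto (fun ε => ∫ z, f z ∂(ν : Measure E) + ε * (G - ∫ z, g z ∂(ν : Measure E)))
      (𝓝[>] 0) (𝓝 (∫ z, f z ∂(ν : Measure E))) :=
    (Continuous.tendsto' (by fun_prop) 0 _ (by ring)).mono_left nhdsWithin_le_nhds
  exact ge_of_tendsto hzero (eventually_mem_nhdsWithin.mono hlower)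

theorem exists_exp_mul_le_add {h : ℝ} (hh : 0 < h) (s : ℝ) {ε : ℝ} (hε : 0 < ε) :
    ∃ C : ℝ, ∀ z : ℝ, Real.exp (s * z) ≤
      ε * (Real.exp ((s - h) * z) + Real.exp ((s + h) * z)) + C := by
  refine ⟨Real.exp (|s| * (|Real.log ε| / h)), fun z => ?_⟩
  rcases le_total |z| (|Real.log ε| / h) with hz | hz
  · refine le_add_of_nonneg_of_le (by positivity) (Real.exp_le_exp.mpr ?_)
    calc s * z ≤ |s| * |z| := (le_abs_self _).trans (abs_mul s z).le
      _ ≤ |s| * (|Real.log ε| / h) := by gcongr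
  · refine le_add_of_le_of_nonneg ?_ (Real.exp_pos _).le
    have hlog : 0 ≤ Real.log ε + h * |z| := by
      have := (div_le_iff₀' hh).mp hz
      linarith [neg_abs_le (Real.log ε)]
    have hsum : Real.exp (h * |z|) ≤ Real.exp (-(h * z)) + Real.exp (h * z) := by
      rcases abs_choice z with hz | hz <;> rw [hz]
      · exact le_add_of_nonneg_left (Real.exp_pos _).le
      · rw [mul_neg]
        exact le_add_of_nonneg_right (Real.exp_pos _).le
    calc Real.exp (s * z) ≤ Real.exp (s * z) * Real.exp (Real.log ε + h * |z|) :=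
          le_mul_of_one_le_right (Real.exp_pos _).le (Real.one_le_exp hlog)
      _ = ε * (Real.exp (s * z) * Real.exp (h * |z|)) := by
          rw [Real.exp_add, Real.exp_log hε]; ring
      _ ≤ ε * (Real.exp (s * z) * (Real.exp (-(h * z)) + Real.exp (h * z))) := by gcongr
      _ = ε * (Real.exp ((s - h) * z) + Real.exp ((s + h) * z)) := by
          rw [mul_add, ← Real.exp_add, ← Real.exp_add]; ring_nf

theorem integrable_and_mgf_eq_of_tendsto_probabilityMeasure (hμ : Tendsto μ l (𝓝 ν)) {Z : E → ℝ}
    (hZ : Continuous Z) {L : ℝ → ℝ} {s : ℝ}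
    (h : ∀ᶠ r in 𝓝 s, (∀ᶠ a in l, Integrable (fun z => Real.exp (r * Z z)) (μ a : Measure E)) ∧
      Tendsto (fun a => mgf Z (μ a : Measure E) r) l (𝓝 (L r))) :
    Integrable (fun z => Real.exp (s * Z z)) (ν : Measure E) ∧ mgf Z (ν : Measure E) s = L s := by
  have hsub : Tendsto (fun b => s - b) (𝓝[>] 0) (𝓝 s) :=
    (Continuous.tendsto' (by fun_prop) 0 s (sub_zero s)).mono_left nhdsWithin_le_nhds
  have hadd : Tendsto (fun b => s + b) (𝓝[>] 0) (𝓝 s) :=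
    (Continuous.tendsto' (by fun_prop) 0 s (add_zero s)).mono_left nhdsWithin_le_nhds
  obtain ⟨b, hb, ⟨hint_sub, hlim_sub⟩, hint_add, hlim_add⟩ :=
    (eventually_mem_nhdsWithin.and ((hsub.eventually h).and (hadd.eventually h))).exists
  have hs := h.self_of_nhds
  refine integrable_and_integral_eq_of_tendsto_probabilityMeasure hμ
    (g := fun z => Real.exp ((s - b) * Z z) + Real.exp ((s + b) * Z z)) (G := L (s - b) + L (s + b))
    (by fun_prop) (fun _ => (Real.exp_pos _).le) (by fun_prop) (fun _ => by positivity)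
    (fun ε hε => (exists_exp_mul_le_add hb s hε).imp fun C hC z => hC (Z z)) hs.1 ?_ hs.2 ?_
  · filter_upwards [hint_sub, hint_add] with a ha ha' using ha.add ha'
  · refine (hlim_sub.add hlim_add).congr' ?_
    filter_upwards [hint_sub, hint_add] with a ha ha' using (integral_add ha ha').symm

end WeakLimits

section MgfUniqueness

variable {Ω Ω' : Type*} [MeasurableSpace Ω] [MeasurableSpace Ω'] {μ : Measure Ω} {μ' : Measure Ω'}
  [IsProbabilityMeasure μ] [IsProbabilityMeasure μ'] {X : Ω → ℝ} {Y : Ω' → ℝ}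

theorem zero_mem_interior_integrableExpSet_of_mgf_eventuallyEq
    (hX : 0 ∈ interior (integrableExpSet X μ)) (h : mgf X μ =ᶠ[𝓝 0] mgf Y μ') :
    0 ∈ interior (integrableExpSet Y μ') := by
  rw [mem_interior_iff_mem_nhds] at hX ⊢
  filter_upwards [hX, h] with r hr heq
  exact mgf_pos_iff.mp (heq ▸ mgf_pos hr)

/-- The complex moment generating functions are analytic on a vertical strip around the imaginary
axis, on which they restrict to the characteristic functions. -/
theorem map_eq_map_of_mgf_eventuallyEq (hX : 0 ∈ interior (integrableExpSet X μ))
    (h : mgf X μ =ᶠ[𝓝 0] mgf Y μ') : μ.map X = μ'.map Y := by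
  have hY := zero_mem_interior_integrableExpSet_of_mgf_eventuallyEq hX h
  have hXm := aemeasurable_of_mem_interior_integrableExpSet hX
  have hYm := aemeasurable_of_mem_interior_integrableExpSet hY
  let S : Set ℂ :=
    {z | z.re ∈ interior (integrableExpSet X μ) ∩ interior (integrableExpSet Y μ')}
  have hS : IsPreconnected S :=
    ((convex_integrableExpSet.interior.inter convex_integrableExpSet.interior).linear_preimage
      Complex.reLm).isPreconnected
  have hlim : Tendsto ((↑) : ℝ → ℂ) (𝓝[≠] 0) (𝓝[≠] ((0 : ℝ) : ℂ)) :=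
    Complex.continuous_ofReal.continuousWithinAt.tendsto_nhdsWithin
      fun _ hr => Complex.ofReal_injective.ne hr
  have hreal : ∃ᶠ z in 𝓝[≠] ((0 : ℝ) : ℂ), complexMGF X μ z = complexMGF Y μ' z := by
    refine hlim.frequently (Eventually.frequently ?_)
    filter_upwards [nhdsWithin_le_nhds h] with r hr
    rw [complexMGF_ofReal, complexMGF_ofReal, hr]
  have hstrip : Set.EqOn (complexMGF X μ) (complexMGF Y μ') S :=
    (analyticOnNhd_complexMGF.mono fun _ hz => hz.1).eqOn_of_preconnected_of_frequently_eq
      (analyticOnNhd_complexMGF.mono fun _ hz => hz.2) hS (by simp [S, hX, hY]) hreal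
  have := Measure.isProbabilityMeasure_map hXm
  have := Measure.isProbabilityMeasure_map hYm
  refine Measure.ext_of_charFun (funext fun r => ?_)
  rw [← complexMGF_mul_I hXm, ← complexMGF_mul_I hYm]
  exact hstrip (by simp [S, hX, hY])

end MgfUniqueness

theorem isTightMeasureSet_setOf_lintegral_le {E : Type*} [TopologicalSpace E] [MeasurableSpace E]
    {f : E → ℝ≥0∞} (hf : Measurable f) (hlim : Tendsto f (cocompact E) (𝓝 ∞)) {C : ℝ≥0∞}
    (hC : C ≠ ∞) : IsTightMeasureSet {μ : Measure E | ∫⁻ z, f z ∂μ ≤ C} := by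
  rw [isTightMeasureSet_iff_exists_isCompact_measure_compl_le]
  intro ε hε
  have hdiv : Tendsto (fun n : ℕ => C / n) atTop (𝓝 0) := by
    simpa using ENNReal.Tendsto.const_div ENNReal.tendsto_nat_nhds_top (.inr hC)
  obtain ⟨n, hn, hn0⟩ :=
    ((hdiv.eventually (eventually_le_nhds hε)).and (eventually_ne_atTop 0)).exists
  obtain ⟨K, hK, hKf⟩ :=
    mem_cocompact.mp (hlim.eventually (eventually_ge_nhds (ENNReal.natCast_lt_top n)))
  refine ⟨K, hK, fun μ hμ => ?_⟩
  calc μ Kᶜ ≤ μ {z | n ≤ f z} := measure_mono hKf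
    _ ≤ (∫⁻ z, f z ∂μ) / n :=
        meas_ge_le_lintegral_div hf.aemeasurable (by exact_mod_cast hn0) (ENNReal.natCast_ne_top n)
    _ ≤ C / n := ENNReal.div_le_div_right hμ _
    _ ≤ ε := hn

/-- The laws `μ a` on `ℝ^ι` have, along `l`, convergent joint moment generating functions near the
origin: for all small `s`, the moment of `exp (s ⬝ᵥ z)` is eventually finite and converges to
`L s`. -/
def MgfTendstoNearZero {ι α : Type*} [Fintype ι] (μ : α → ProbabilityMeasure (ι → ℝ))
    (l : Filter α) (L : (ι → ℝ) → ℝ) : Prop :=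
  ∀ᶠ s in 𝓝 0, (∀ᶠ a in l, Integrable (fun z => Real.exp (s ⬝ᵥ z)) (μ a : Measure (ι → ℝ))) ∧
    Tendsto (fun a => ∫ z, Real.exp (s ⬝ᵥ z) ∂(μ a : Measure (ι → ℝ))) l (𝓝 (L s))

section Curtiss

variable {ι α : Type*} [Fintype ι]

theorem tendsto_cocompact_sum_exp {b : ℝ} (hb : 0 < b) :
    Tendsto (fun z : ι → ℝ => ∑ i, (Real.exp (b * z i) + Real.exp (-b * z i))) (cocompact (ι → ℝ))
      atTop := by
  refine tendsto_atTop_mono (fun z => ?_) (tendsto_norm_cocompact_atTop.const_mul_atTop hb)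
  rw [← le_div_iff₀' hb, pi_norm_le_iff_of_nonneg (by positivity)]
  intro i
  rw [le_div_iff₀' hb, Real.norm_eq_abs]
  refine le_trans ?_ (Finset.single_le_sum
    (f := fun i => Real.exp (b * z i) + Real.exp (-b * z i)) (fun _ _ => by positivity)
    (Finset.mem_univ i))
  have hpos := Real.add_one_le_exp (b * z i)
  have hneg := Real.add_one_le_exp (-b * z i)
  rcases abs_choice (z i) with hz | hz <;> rw [hz] <;>
    linarith [Real.exp_pos (b * z i), Real.exp_pos (-b * z i)]

namespace MgfTendstoNearZero

variable {l : Filter α} {μ : α → ProbabilityMeasure (ι → ℝ)} {L : (ι → ℝ) → ℝ}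

theorem mono (h : MgfTendstoNearZero μ l L) {l' : Filter α} (hl : l' ≤ l) :
    MgfTendstoNearZero μ l' L :=
  Eventually.mono h fun _ hs => ⟨hl hs.1, hs.2.mono_left hl⟩

theorem congr (h : MgfTendstoNearZero μ l L) {L' : (ι → ℝ) → ℝ} (hL : L =ᶠ[𝓝 0] L') :
    MgfTendstoNearZero μ l L' := by
  filter_upwards [h, hL] with s hs heq using ⟨hs.1, heq ▸ hs.2⟩

theorem eventually_dotProduct (h : MgfTendstoNearZero μ l L) (s : ι → ℝ) :
    ∀ᶠ r : ℝ in 𝓝 0,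
      (∀ᶠ a in l, Integrable (fun z => Real.exp (r * s ⬝ᵥ z)) (μ a : Measure (ι → ℝ))) ∧
        Tendsto (fun a => mgf (s ⬝ᵥ ·) (μ a : Measure (ι → ℝ)) r) l (𝓝 (L (r • s))) := by
  have hsmul : Tendsto (fun r : ℝ => r • s) (𝓝 0) (𝓝 0) :=
    Continuous.tendsto' (by fun_prop) 0 0 (zero_smul ℝ s)
  simpa only [mgf, smul_dotProduct, smul_eq_mul] using hsmul.eventually h

theorem exists_eventually_integral_sum_exp_le (h : MgfTendstoNearZero μ l L) :
    ∃ b > 0, ∃ M, ∀ᶠ a in l,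
      Integrable (fun z => ∑ i, (Real.exp (b * z i) + Real.exp (-b * z i)))
        (μ a : Measure (ι → ℝ)) ∧
      ∫ z, ∑ i, (Real.exp (b * z i) + Real.exp (-b * z i)) ∂(μ a : Measure (ι → ℝ)) ≤ M := by
  classical
  have hcoord := eventually_all.mpr fun i => h.eventually_dotProduct (Pi.single i 1)
  simp only [single_one_dotProduct, mgf] at hcoord
  have hneg : Tendsto (fun b : ℝ => -b) (𝓝[>] 0) (𝓝 0) :=
    (Continuous.tendsto' (by fun_prop) 0 0 neg_zero).mono_left nhdsWithin_le_nhds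
  obtain ⟨b, hb, hpos, hneg⟩ := (eventually_mem_nhdsWithin.and
    (Eventually.and (nhdsWithin_le_nhds hcoord) (hneg.eventually hcoord))).exists
  have hlim := tendsto_finsetSum Finset.univ fun i _ => (hpos i).2.add (hneg i).2
  refine ⟨b, hb, ∑ i, (L (b • Pi.single i 1) + L (-b • Pi.single i 1)) + 1, ?_⟩
  filter_upwards [eventually_all.mpr fun i => (hpos i).1, eventually_all.mpr fun i => (hneg i).1,
    hlim.eventually_le_const (lt_add_one _)] with a ha ha' hle
  have hsum (i : ι) : Integrable (fun z => Real.exp (b * z i) + Real.exp (-b * z i))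
      (μ a : Measure (ι → ℝ)) := (ha i).add (ha' i)
  refine ⟨integrable_finsetSum _ fun i _ => hsum i, ?_⟩
  rw [integral_finsetSum _ fun i _ => hsum i]
  simpa only [integral_add (ha _) (ha' _)] using hle

theorem exists_tendsto {l : Ultrafilter α} (h : MgfTendstoNearZero μ l L) :
    ∃ ν : ProbabilityMeasure (ι → ℝ), Tendsto μ l (𝓝 ν) := by
  obtain ⟨b, hb, M, hM⟩ := h.exists_eventually_integral_sum_exp_le
  let g (z : ι → ℝ) : ℝ := ∑ i, (Real.exp (b * z i) + Real.exp (-b * z i))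
  let S : Set (ProbabilityMeasure (ι → ℝ)) :=
    {ρ | ∫⁻ z, ENNReal.ofReal (g z) ∂(ρ : Measure (ι → ℝ)) ≤ ENNReal.ofReal M}
  have hS : IsCompact (closure S) := by
    refine isCompact_closure_of_isTightMeasureSet ((isTightMeasureSet_setOf_lintegral_le
      (f := fun z => ENNReal.ofReal (g z)) (C := ENNReal.ofReal M) (by fun_prop)
      (ENNReal.tendsto_ofReal_atTop.comp (tendsto_cocompact_sum_exp hb))
      ENNReal.ofReal_ne_top).subset ?_)
    rintro _ ⟨ρ, hρ, rfl⟩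
    exact hρ
  have hmem : ∀ᶠ a in (l : Filter α), μ a ∈ closure S := by
    filter_upwards [hM] with a ⟨hint, hle⟩
    refine subset_closure ?_
    change ∫⁻ z, ENNReal.ofReal (g z) ∂(μ a : Measure (ι → ℝ)) ≤ ENNReal.ofReal M
    rw [← ofReal_integral_eq_lintegral_ofReal hint (ae_of_all _ fun z => by positivity)]
    exact ENNReal.ofReal_le_ofReal hle
  obtain ⟨ν, -, hν⟩ := hS.ultrafilter_le_nhds (l.map μ) (le_principal_iff.mpr hmem)
  exact ⟨ν, hν⟩

/-- The Cramér–Wold device reduces the identification of a weak limit point to its linear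
forms. -/
theorem tendsto {ν : ProbabilityMeasure (ι → ℝ)}
    (h : MgfTendstoNearZero μ l fun s => ∫ z, Real.exp (s ⬝ᵥ z) ∂(ν : Measure (ι → ℝ))) :
    Tendsto μ l (𝓝 ν) := by
  classical
  refine (tendsto_iff_ultrafilter _ _ _).mpr fun g hg => ?_
  obtain ⟨ρ, hρ⟩ := (h.mono hg).exists_tendsto
  have hform (s : ι → ℝ) :
      (ρ : Measure (ι → ℝ)).map (s ⬝ᵥ ·) = (ν : Measure (ι → ℝ)).map (s ⬝ᵥ ·) := by
    have hmgf := ((h.mono hg).eventually_dotProduct s).eventually_nhds.mono fun r hr =>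
      integrable_and_mgf_eq_of_tendsto_probabilityMeasure hρ (by fun_prop) hr
    refine map_eq_map_of_mgf_eventuallyEq
      (mem_interior_iff_mem_nhds.mpr (hmgf.mono fun r hr => hr.1)) ?_
    filter_upwards [hmgf] with r hr
    simpa only [mgf, smul_dotProduct, smul_eq_mul] using hr.2
  suffices hρν : (ρ : Measure (ι → ℝ)) = ν by rwa [← Subtype.ext hρν]
  refine Measure.ext_of_charFunDual (funext fun Λ => ?_)
  have hΛ : (Λ : (ι → ℝ) → ℝ) = ((fun i => Λ fun j => if i = j then 1 else 0) ⬝ᵥ ·) := by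
    ext z
    simpa only [dotProduct, mul_comm, smul_eq_mul] using! Λ.toLinearMap.pi_apply_eq_sum_univ z
  rw [charFunDual_eq_charFun_map_one, charFunDual_eq_charFun_map_one, hΛ, hform]

end MgfTendstoNearZero

end Curtiss

theorem integral_exp_dotProduct_of_iIndepFun {Ω ι : Type*} [MeasurableSpace Ω] [Fintype ι]
    {P : Measure Ω} {W : ι → Ω → ℝ} (hW : ∀ i, AEMeasurable (W i) P) (hind : iIndepFun W P)
    (s : ι → ℝ) :
    ∫ ω, Real.exp (s ⬝ᵥ fun i => W i ω) ∂P = ∏ i, mgf (W i) P (s i) := by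
  have hprod := (hind.comp (fun i y => s i * y) fun i => by fun_prop).mgf_sum₀ (t := 1)
    (fun i => (hW i).const_mul (s i)) Finset.univ
  simpa only [Function.comp_def, mgf_const_mul, mul_one, mgf, Finset.sum_apply, one_mul,
    dotProduct] using hprod

theorem eventually_forall_lt_of_pos {ι : Type*} [Finite ι] {b : ℝ} (hb : 0 < b) :
    ∀ᶠ s : ι → ℝ in 𝓝 0, ∀ i, s i < b :=
  eventually_all.mpr fun i => (continuous_apply i).tendsto (0 : ι → ℝ) |>.eventually_lt_const hb

namespace IsLambert

variable {Ω : Type*} [MeasurableSpace Ω] {P : Measure Ω} [IsProbabilityMeasure P]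

theorem mgf_eq {Z : Ω → ℝ} {r s : ℝ} (h : IsLambert Z P r) (hs : s ≤ Real.exp (-1)) :
    mgf Z P s = Real.exp (r * treeFunction s) := by
  rcases eq_or_ne s 0 with rfl | hs0
  · rw [mgf_zero, treeFunction_zero, mul_zero, Real.exp_zero]
  · rw [(h.2 s hs hs0).2, treeFunction_div_rpow hs hs0]

theorem integral_exp_dotProduct {ι : Type*} [Fintype ι] {W : ι → Ω → ℝ} {x s : ι → ℝ}
    (h : ∀ i, IsLambert (W i) P (x i)) (hind : iIndepFun W P) (hs : ∀ i, s i ≤ Real.exp (-1)) :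
    ∫ ω, Real.exp (s ⬝ᵥ fun i => W i ω) ∂P = Real.exp (∑ i, x i * treeFunction (s i)) := by
  rw [integral_exp_dotProduct_of_iIndepFun (fun i => (h i).1) hind, Real.exp_sum]
  exact Finset.prod_congr rfl fun i _ => (h i).mgf_eq (hs i)

end IsLambert

namespace ContinuumPolyaWalk.StaysInOrthant

variable {Ω : Type*} [MeasurableSpace Ω] {P : Measure Ω} [IsProbabilityMeasure P] {c : ℕ}
  {x : Fin c → ℝ} {w : ContinuumPolyaWalk P (expDiagonalLaw c) x}

theorem aemeasurable_exp_neg_smul_X (hw : w.StaysInOrthant) (t : ℝ) :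
    AEMeasurable (fun ω => Real.exp (-t) • w.X t ω) P :=
  (hw.aemeasurable_X t).const_smul (Real.exp (-t))

/-- The law of the rescaled position `exp (-t) • X(t)`, as a point of the space of probability
measures with the topology of weak convergence. -/
noncomputable def scaledLaw (hw : w.StaysInOrthant) (t : ℝ) : ProbabilityMeasure (Fin c → ℝ) :=
  ⟨P.map fun ω => Real.exp (-t) • w.X t ω,
    Measure.isProbabilityMeasure_map (hw.aemeasurable_exp_neg_smul_X t)⟩

theorem integrable_scaledLaw_iff (hw : w.StaysInOrthant) (t : ℝ) {f : (Fin c → ℝ) → ℝ}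
    (hf : Measurable f) : Integrable f (hw.scaledLaw t : Measure (Fin c → ℝ)) ↔
      Integrable (fun ω => f (Real.exp (-t) • w.X t ω)) P :=
  integrable_map_measure hf.aestronglyMeasurable (hw.aemeasurable_exp_neg_smul_X t)

theorem integral_scaledLaw (hw : w.StaysInOrthant) (t : ℝ) {f : (Fin c → ℝ) → ℝ}
    (hf : Measurable f) : ∫ z, f z ∂(hw.scaledLaw t : Measure (Fin c → ℝ)) =
      ∫ ω, f (Real.exp (-t) • w.X t ω) ∂P :=
  integral_map (hw.aemeasurable_exp_neg_smul_X t) hf.aestronglyMeasurable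

theorem mgfTendstoNearZero_scaledLaw (hw : w.StaysInOrthant) :
    MgfTendstoNearZero hw.scaledLaw atTop fun s => Real.exp (∑ i, x i * treeFunction (s i)) := by
  filter_upwards [eventually_forall_lt_of_pos (Real.exp_pos (-1))] with s hs
  refine ⟨?_, ?_⟩
  · filter_upwards [eventually_ge_atTop 0] with t ht
    rw [hw.integrable_scaledLaw_iff t (by fun_prop)]
    exact (hw.integrable_and_integral_exp_dotProduct_X ht hs).1
  · exact (hw.tendsto_integral_exp_dotProduct_X hs).congr fun t =>
      (hw.integral_scaledLaw t (f := fun z => Real.exp (s ⬝ᵥ z)) (by fun_prop)).symm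

theorem integrable_and_mgf_apply_of_tendsto_scaledLaw (hw : w.StaysInOrthant)
    {l : Filter ℝ} [l.NeBot] (hl : l ≤ atTop) {ν : ProbabilityMeasure (Fin c → ℝ)}
    (hν : Tendsto hw.scaledLaw l (𝓝 ν)) (i : Fin c) {s : ℝ} (hs : s < Real.exp (-1)) :
    Integrable (fun z => Real.exp (s * z i)) (ν : Measure (Fin c → ℝ)) ∧
      mgf (fun z => z i) (ν : Measure (Fin c → ℝ)) s = Real.exp (x i * treeFunction s) := by
  refine integrable_and_mgf_eq_of_tendsto_probabilityMeasure hν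
    (L := fun s => Real.exp (x i * treeFunction s)) (continuous_apply i) ?_
  filter_upwards [eventually_lt_nhds hs] with r hr
  refine ⟨hl ?_, ((hw.tendsto_mgf_exp_neg_mul_X_apply i hr.le).mono_left hl).congr fun t =>
    (hw.integral_scaledLaw t (f := fun z => Real.exp (r * z i)) (by fun_prop)).symm⟩
  filter_upwards [eventually_ge_atTop 0] with t ht
  rw [hw.integrable_scaledLaw_iff t (by fun_prop)]
  exact (hw.integrable_and_mgf_exp_neg_mul_X_apply i ht hr.le).1

/-- The walk itself produces the Lambert laws, as coordinates of a weak limit point. -/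
theorem exists_isLambert (hw : w.StaysInOrthant) (i : Fin c) :
    ∃ μ : Measure ℝ, IsProbabilityMeasure μ ∧ IsLambert id μ (x i) := by
  let l : Ultrafilter ℝ := .of atTop
  obtain ⟨ν, hν⟩ := (hw.mgfTendstoNearZero_scaledLaw.mono
    (Ultrafilter.of_le (f := atTop))).exists_tendsto (l := l)
  have hcoord : Measurable fun z : Fin c → ℝ => z i := measurable_pi_apply i
  refine ⟨(ν : Measure (Fin c → ℝ)).map fun z => z i,
    Measure.isProbabilityMeasure_map hcoord.aemeasurable, aemeasurable_id, fun s hs hs0 => ?_⟩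
  obtain ⟨hint, hmgf⟩ := integrable_and_mgf_eq_of_continuousWithinAt
    (g := fun s => Real.exp (x i * treeFunction s)) hcoord.aemeasurable
    (fun r hr => hw.integrable_and_mgf_apply_of_tendsto_scaledLaw (Ultrafilter.of_le (f := atTop))
      hν i (hr.trans_le hs))
    (((continuousOn_treeFunction s hs).mono fun r hr => (le_of_lt hr).trans hs).const_mul _).rexp
  rw [mgf_id_map hcoord.aemeasurable, hmgf, treeFunction_div_rpow hs hs0]
  exact ⟨(integrable_map_measure (Measurable.aestronglyMeasurable (by fun_prop))
    hcoord.aemeasurable).mpr hint, rfl⟩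

theorem tendstoInDistribution (hw : w.StaysInOrthant) {Ω' : Type*} [MeasurableSpace Ω']
    {P' : Measure Ω'} [IsProbabilityMeasure P'] {W : Fin c → Ω' → ℝ}
    (hW : ∀ i, IsLambert (W i) P' (x i)) (hind : iIndepFun W P') :
    TendstoInDistribution (fun t ω => Real.exp (-t) • w.X t ω) atTop (fun ω' i => W i ω')
      (fun _ => P) P' where
  forall_aemeasurable := hw.aemeasurable_exp_neg_smul_X
  aemeasurable_limit := aemeasurable_pi_lambda _ fun i => (hW i).1
  tendsto := by
    have hWm : AEMeasurable (fun ω' i => W i ω') P' := aemeasurable_pi_lambda _ fun i => (hW i).1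
    refine (hw.mgfTendstoNearZero_scaledLaw.congr ?_).tendsto
    filter_upwards [eventually_forall_lt_of_pos (Real.exp_pos (-1))] with s hs
    rw [ProbabilityMeasure.coe_mk,
      integral_map hWm (Measurable.aestronglyMeasurable (by fun_prop)),
      IsLambert.integral_exp_dotProduct hW hind fun i => (hs i).le]

end ContinuumPolyaWalk.StaysInOrthant

theorem mainTheorem7 {Ω Ω' : Type*} [MeasurableSpace Ω] [MeasurableSpace Ω']
    (P : Measure Ω) [IsProbabilityMeasure P] {c : ℕ} (x : Fin c → ℝ)
    (hx : ∀ i, 0 ≤ x i) (hx0 : x ≠ 0) (w : ContinuumPolyaWalk P (expDiagonalLaw c) x) :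
    (∀ (i : Fin c) (t u : ℝ), 0 ≤ t → u < 1 → u * Real.exp (t - u) ≤ Real.exp (-1) →
      Integrable (fun ω => Real.exp (u * w.X t ω i)) P ∧
      mgf (fun ω => w.X t ω i) P u =
        Real.exp (-(x i * lambertW (-(u * Real.exp (t - u)))))) ∧
    (∀ (i : Fin c) (s : ℝ), s ≤ Real.exp (-1) → s ≠ 0 →
      Tendsto (fun t : ℝ => mgf (fun ω => Real.exp (-t) * w.X t ω i) P s) atTop
        (𝓝 ((treeFunction s / s) ^ x i))) ∧
    (∀ i : Fin c, ∃ μ : Measure ℝ, IsProbabilityMeasure μ ∧ IsLambert id μ (x i)) ∧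
    (∀ (P' : Measure Ω') [IsProbabilityMeasure P'] (W : Fin c → Ω' → ℝ),
      (∀ i, IsLambert (W i) P' (x i)) → iIndepFun W P' →
        TendstoInDistribution (fun (t : ℝ) ω => Real.exp (-t) • w.X t ω) atTop
          (fun ω' i => W i ω') (fun _ => P) P') := by
  have hw : w.StaysInOrthant :=
    ContinuumPolyaWalk.staysInOrthant (ae_nonneg_expDiagonalLaw c) hx hx0 w
  refine ⟨fun i t u ht hu h => ?_, fun i s hs hs0 => ?_, hw.exists_isLambert,
    fun P' _ W hW hind => hw.tendstoInDistribution hW hind⟩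
  · rw [← mul_neg]
    exact hw.integrable_and_mgf_X_apply i ht hu h
  · rw [treeFunction_div_rpow hs hs0]
    exact hw.tendsto_mgf_exp_neg_mul_X_apply i hs
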